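/- Let $\mathcal X,\mathcal Y_1,\mathcal Y_2$ be finite sets and let $p(y_1,y_2\mid x)$ be the transition probabilities of a discrete memoryless broadcast channel with input alphabet $\mathcal X$ and output alphabets $\mathcal Y_1,\mathcal Y_2$. A code of length $n$ with rates $R_1,R_2\ge 0$ consists of an encoder $\mathcal W_1\times\mathcal W_2\to\mathcal X^n$ and decoders $\mathcal Y_1^n\to\mathcal W_1$, $\mathcal Y_2^n\to\mathcal W_2$, where $|\mathcal W_j|=\lceil 2^{nR_j}\rceil$; its probability of error is the probability that at least one decoder is wrong when the message pair $(W_1,W_2)$ is uniform on $\mathcal W_1\times\mathcal W_2$. The pair $(R_1,R_2)$ is achievable if there is a sequence of such codes (one for each $n$) whose probability of error tends to $0$, and the capacity region is the closure in $\mathbb R^2$ of the set of achievable pairs. Below, auxiliary random variables $U,V$ take values in arbitrary finite sets, $(U,V)\to X\to(Y_1,Y_2)$ is always a Markov chain in which $(Y_1,Y_2)$ is the channel output for the input $X$, and mutual informations are in bits. A set $\mathcal P$ of probability distributions on $\mathcal X$ is called a sufficient class if for every joint distribution $p(u,v,x)$ there is a joint distribution $q(u,v,x)$ (possibly with other finite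 alphabets for $U$ and $V$) whose marginal $q(x)$ lies in $\mathcal P$ and such that, for $i=1,2$, none of $$I(U;Y_i),\quad I(V;Y_i),\quad I(X;Y_i\mid U),\quad I(X;Y_i\mid V),\quad I(X;Y_i)$$ is smaller under $q$ than under $p$. The receiver $Y_1$ is essentially less noisy compared to $Y_2$ if there is a sufficient class $\mathcal P$ such that $I(U;Y_2)\le I(U;Y_1)$ for all $U\to X\to(Y_1,Y_2)$ with $p(x)\in\mathcal P$. Theorem. Suppose that $Y_1$ is essentially less noisy compared to $Y_2$, and let $\mathcal P$ be any sufficient class with $I(U;Y_2)\le I(U;Y_1)$ for all $U\to X\to(Y_1,Y_2)$ with $p(x)\in\mathcal P$. Then the capacity region equals the set of all pairs $(R_1,R_2)$ with $R_1,R_2\ge 0$ such that $$R_2\le I(U;Y_2),\qquad R_1+R_2\le I(U;Y_2)+I(X;Y_1\mid U)$$ for some $U\to X\to(Y_1,Y_2)$ with $p(x)\in\mathcal P$. -/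

import Mathlib

open Filter Topology

noncomputable section

/-! Random variables on a finite probability space: `Ω` is a finite set, `r : Ω → ℝ` its
probability mass function, and a random variable is a function on `Ω`. -/

namespace FinProb

open Classical in
/-- The probability mass function of the random variable `A` when `Ω` carries the mass
function `r`, i.e. `a ↦ P(A = a)`. -/
def law {Ω α : Type*} [Fintype Ω] (r : Ω → ℝ) (A : Ω → α) (a : α) : ℝ :=
  ∑ ω, if A ω = a then r ω else 0

/-- Shannon entropy `H(A) = - ∑ₐ P(A = a) log₂ P(A = a)`, in bits (with `0 log 0 = 0`). -/
def entropy {Ω α : Type*} [Fintype Ω] [Fintype α] (r : Ω → ℝ) (A : Ω → α) : ℝ :=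
  ∑ a, Real.negMulLog (law r A a) / Real.log 2

/-- Mutual information `I(A;B) = H(A) + H(B) - H(A,B)`, in bits. -/
def mutualInfo {Ω α β : Type*} [Fintype Ω] [Fintype α] [Fintype β]
    (r : Ω → ℝ) (A : Ω → α) (B : Ω → β) : ℝ :=
  entropy r A + entropy r B - entropy r (fun ω => (A ω, B ω))

/-- Conditional mutual information `I(A;B|C) = H(A,C) + H(B,C) - H(A,B,C) - H(C)`, in bits. -/
def condMutualInfo {Ω α β γ : Type*} [Fintype Ω] [Fintype α] [Fintype β] [Fintype γ]
    (r : Ω → ℝ) (A : Ω → α) (B : Ω → β) (C : Ω → γ) : ℝ :=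
  entropy r (fun ω => (A ω, C ω)) + entropy r (fun ω => (B ω, C ω))
    - entropy r (fun ω => (A ω, B ω, C ω)) - entropy r C

end FinProb

open FinProb

/-- A two-receiver broadcast channel with input alphabet `X` and output alphabets `Y₁`, `Y₂`:
`prob x (y₁, y₂)` is the transition probability `p(y₁, y₂ | x)`. -/
structure BroadcastChannel (X Y₁ Y₂ : Type*) [Fintype Y₁] [Fintype Y₂] where
  prob : X → Y₁ × Y₂ → ℝ
  nonneg : ∀ x y, 0 ≤ prob x y
  sum_eq_one : ∀ x, ∑ y, prob x y = 1

/-- An `(M₁, M₂)` block code of length `n`: an encoder and two decoders. -/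
structure BroadcastCode (X Y₁ Y₂ : Type*) (M₁ M₂ n : ℕ) where
  enc : Fin M₁ × Fin M₂ → (Fin n → X)
  dec₁ : (Fin n → Y₁) → Fin M₁
  dec₂ : (Fin n → Y₂) → Fin M₂

namespace BroadcastChannel

variable {X Y₁ Y₂ : Type*} [Fintype X] [Fintype Y₁] [Fintype Y₂]

/-- The probability of error of a code over `n` memoryless uses of the channel, the message pair
being uniformly distributed. -/
def errorProb {X Y₁ Y₂ : Type*} [Fintype Y₁] [Fintype Y₂] (ch : BroadcastChannel X Y₁ Y₂)
    {M₁ M₂ n : ℕ} (c : BroadcastCode X Y₁ Y₂ M₁ M₂ n) : ℝ :=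
  (1 / ((M₁ : ℝ) * (M₂ : ℝ))) * ∑ w₁ : Fin M₁, ∑ w₂ : Fin M₂,
    ∑ y₁ : Fin n → Y₁, ∑ y₂ : Fin n → Y₂,
      if c.dec₁ y₁ ≠ w₁ ∨ c.dec₂ y₂ ≠ w₂ then
        ∏ i, ch.prob (c.enc (w₁, w₂) i) (y₁ i, y₂ i)
      else 0

/-- The pair `(R₁, R₂)` of nonnegative rates is achievable: there is a sequence of codes with
`⌈2 ^ (n R₁)⌉` and `⌈2 ^ (n R₂)⌉` messages, of length `n = 0, 1, 2, …`, whose probability of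
error tends to zero. -/
def Achievable {X Y₁ Y₂ : Type*} [Fintype Y₁] [Fintype Y₂] (ch : BroadcastChannel X Y₁ Y₂)
    (R : ℝ × ℝ) : Prop :=
  0 ≤ R.1 ∧ 0 ≤ R.2 ∧
    ∃ c : ∀ n : ℕ, BroadcastCode X Y₁ Y₂
        ⌈(2 : ℝ) ^ ((n : ℝ) * R.1)⌉₊ ⌈(2 : ℝ) ^ ((n : ℝ) * R.2)⌉₊ n,
      Tendsto (fun n => ch.errorProb (c n)) atTop (𝓝 0)

/-- The capacity region: the closure of the set of achievable rate pairs. -/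
def capacityRegion {X Y₁ Y₂ : Type*} [Fintype Y₁] [Fintype Y₂] (ch : BroadcastChannel X Y₁ Y₂) :
    Set (ℝ × ℝ) :=
  closure {R | ch.Achievable R}

/-- The joint mass function of `(S, X, Y₁, Y₂)` when `(S, X)` has mass function `p` and
`S → X → (Y₁, Y₂)` is a Markov chain whose second step is the channel. -/
def joint {X Y₁ Y₂ : Type*} [Fintype Y₁] [Fintype Y₂] (ch : BroadcastChannel X Y₁ Y₂)
    {S : Type*} (p : S × X → ℝ) : S × X × Y₁ × Y₂ → ℝ :=
  fun ω => p (ω.1, ω.2.1) * ch.prob ω.2.1 ω.2.2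

section Information

/-- `I(A(S); Y₁)`, where `A(S)` is a function of the auxiliary variable `S`. -/
def infoAux₁ (ch : BroadcastChannel X Y₁ Y₂) {S T : Type*} [Fintype S] [Fintype T]
    (p : S × X → ℝ) (A : S → T) : ℝ :=
  mutualInfo (ch.joint p) (fun ω => A ω.1) (fun ω => ω.2.2.1)

/-- `I(A(S); Y₂)`. -/
def infoAux₂ (ch : BroadcastChannel X Y₁ Y₂) {S T : Type*} [Fintype S] [Fintype T]
    (p : S × X → ℝ) (A : S → T) : ℝ :=
  mutualInfo (ch.joint p) (fun ω => A ω.1) (fun ω => ω.2.2.2)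

/-- `I(X; Y₁ | A(S))`. -/
def infoInputGiven₁ (ch : BroadcastChannel X Y₁ Y₂) {S T : Type*} [Fintype S] [Fintype T]
    (p : S × X → ℝ) (A : S → T) : ℝ :=
  condMutualInfo (ch.joint p) (fun ω => ω.2.1) (fun ω => ω.2.2.1) (fun ω => A ω.1)

/-- `I(X; Y₂ | A(S))`. -/
def infoInputGiven₂ (ch : BroadcastChannel X Y₁ Y₂) {S T : Type*} [Fintype S] [Fintype T]
    (p : S × X → ℝ) (A : S → T) : ℝ :=
  condMutualInfo (ch.joint p) (fun ω => ω.2.1) (fun ω => ω.2.2.2) (fun ω => A ω.1)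

/-- `I(X; Y₁)`. -/
def infoInput₁ (ch : BroadcastChannel X Y₁ Y₂) {S : Type*} [Fintype S] (p : S × X → ℝ) : ℝ :=
  mutualInfo (ch.joint p) (fun ω => ω.2.1) (fun ω => ω.2.2.1)

/-- `I(X; Y₂)`. -/
def infoInput₂ (ch : BroadcastChannel X Y₁ Y₂) {S : Type*} [Fintype S] (p : S × X → ℝ) : ℝ :=
  mutualInfo (ch.joint p) (fun ω => ω.2.1) (fun ω => ω.2.2.2)

end Information

/-- `P` is a sufficient class of input distributions: every `p(u,v,x)` is dominated by some
`q(u,v,x)` with `q(x) ∈ P`. The auxiliary variables `U` and `V` range over arbitrary finite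
alphabets, which may differ between `p` and `q`. -/
def IsSufficientClass (ch : BroadcastChannel X Y₁ Y₂) (P : Set (X → ℝ)) : Prop :=
  P ⊆ stdSimplex ℝ X ∧
  ∀ (k l : ℕ) (p : (Fin k × Fin l) × X → ℝ), p ∈ stdSimplex ℝ ((Fin k × Fin l) × X) →
    ∃ (k' l' : ℕ) (q : (Fin k' × Fin l') × X → ℝ),
      q ∈ stdSimplex ℝ ((Fin k' × Fin l') × X) ∧
      law q Prod.snd ∈ P ∧
      ch.infoAux₁ p Prod.fst ≤ ch.infoAux₁ q Prod.fst ∧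
      ch.infoAux₂ p Prod.fst ≤ ch.infoAux₂ q Prod.fst ∧
      ch.infoAux₁ p Prod.snd ≤ ch.infoAux₁ q Prod.snd ∧
      ch.infoAux₂ p Prod.snd ≤ ch.infoAux₂ q Prod.snd ∧
      ch.infoInputGiven₁ p Prod.fst ≤ ch.infoInputGiven₁ q Prod.fst ∧
      ch.infoInputGiven₂ p Prod.fst ≤ ch.infoInputGiven₂ q Prod.fst ∧
      ch.infoInputGiven₁ p Prod.snd ≤ ch.infoInputGiven₁ q Prod.snd ∧
      ch.infoInputGiven₂ p Prod.snd ≤ ch.infoInputGiven₂ q Prod.snd ∧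
      ch.infoInput₁ p ≤ ch.infoInput₁ q ∧
      ch.infoInput₂ p ≤ ch.infoInput₂ q

/-- Whenever `U → X → (Y₁, Y₂)` and `p(x) ∈ P`, one has `I(U;Y₂) ≤ I(U;Y₁)`. -/
def IsLessNoisyOn (ch : BroadcastChannel X Y₁ Y₂) (P : Set (X → ℝ)) : Prop :=
  ∀ (k : ℕ) (p : Fin k × X → ℝ), p ∈ stdSimplex ℝ (Fin k × X) → law p Prod.snd ∈ P →
    ch.infoAux₂ p id ≤ ch.infoAux₁ p id

/-- `P` is a sufficient class that makes `Y₁` essentially less noisy compared to `Y₂`. -/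
def MakesEssentiallyLessNoisy (ch : BroadcastChannel X Y₁ Y₂) (P : Set (X → ℝ)) : Prop :=
  ch.IsSufficientClass P ∧ ch.IsLessNoisyOn P

/-- The receiver `Y₁` is essentially less noisy compared to the receiver `Y₂`. -/
def EssentiallyLessNoisy (ch : BroadcastChannel X Y₁ Y₂) : Prop :=
  ∃ P : Set (X → ℝ), ch.MakesEssentiallyLessNoisy P

/-- The union, over all `U → X → (Y₁, Y₂)` with `p(x) ∈ P`, of the nonnegative rate pairs with
`R₂ ≤ I(U;Y₂)` and `R₁ + R₂ ≤ I(U;Y₂) + I(X;Y₁|U)`. -/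
def superpositionRegion (ch : BroadcastChannel X Y₁ Y₂) (P : Set (X → ℝ)) : Set (ℝ × ℝ) :=
  {R | 0 ≤ R.1 ∧ 0 ≤ R.2 ∧
    ∃ (k : ℕ) (p : Fin k × X → ℝ), p ∈ stdSimplex ℝ (Fin k × X) ∧ law p Prod.snd ∈ P ∧
      R.2 ≤ ch.infoAux₂ p id ∧
      R.1 + R.2 ≤ ch.infoAux₂ p id + ch.infoInputGiven₁ p id}

end BroadcastChannel

end

/-! The two inclusions are independent: the converse uses only that `P` is sufficient, achievability
only that `Y₁` is less noisy on `P`.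

Converse. For a code of length n put V_i = (W₂, Y₁^{i-1}, Y₂,{i+1}^n). Fano's inequality bounds nR₂
by I(W₂;Y₂ⁿ) and n(R₁+R₂) by I(W₂;Y₂ⁿ) + I(W₁;Y₁ⁿ|W₂), up to error terms. The Csiszár sum identity
turns H(Y₁ⁿ|W₂) - H(Y₂ⁿ|W₂) into the sum of H(Y₁ᵢ|V_i) - H(Y₂ᵢ|V_i), so the second bound is at most
the sum of I(V_i;Y₂ᵢ) + I(Xᵢ;Y₁ᵢ|V_i); the first is at most the sum of I(V_i;Y₂ᵢ)
(`BroadcastCode.mem_sumRegion`). Hence, for every broadcast channel, achievable pairs lie in the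
region `sumRegion`, taken over all input laws. Conditional entropies given V are averages of
functions of p(x|v), so the region is described by a convex hull of a compact set in finite
dimension. This makes it closed (`isClosed_sumRegion`) and lets the n letters be averaged into one
(`sum_mem_sumRegion`). Sufficiency then replaces the auxiliary variable by one whose input law lies
in `P` (`mem_superpositionRegion_of_mem_sumRegion`).

Achievability. In superposition coding the cloud centres carry W₂ and a part of W₁ of rate r, the
satellites the rest of W₁, of rate s. Receiver 2 decodes the cloud if R₂ + r < I(U;Y₂). Receiver 1
decodes everything if s < I(X;Y₁|U) and R₂ + r + s < I(X;Y₁) = I(U;Y₁) + I(X;Y₁|U). Since I(U;Y₂) ≤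
I(U;Y₁), the last condition follows from the bound on R₁ + R₂. Decoding is by likelihood ratio
tests: false alarms are controlled by a change of measure (`sum_false_alarm_le`), missed detections
by the weak law of large numbers (`tendsto_missed_detection`), and a random codebook by its mean
error (`exists_superposition_code`). -/

noncomputable section

open FinProb

namespace FinProb

/-! ### Entropy inequalities on finite probability spaces. -/

section Basics

variable {Ω α β γ : Type*} [Fintype Ω] [Fintype α] [Fintype β] [Fintype γ]

theorem sum_law_mul (r : Ω → ℝ) (A : Ω → α) (g : α → ℝ) :
    ∑ a, law r A a * g a = ∑ ω, r ω * g (A ω) := by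
  classical
  simp only [law, Finset.sum_mul, ite_mul, zero_mul]
  rw [Finset.sum_comm]
  refine Finset.sum_congr rfl fun ω _ => ?_
  simp

theorem sum_law (r : Ω → ℝ) (A : Ω → α) : ∑ a, law r A a = ∑ ω, r ω := by
  simpa using sum_law_mul r A (fun _ => 1)

omit [Fintype α] in
theorem law_nonneg {r : Ω → ℝ} (hr : ∀ ω, 0 ≤ r ω) (A : Ω → α) (a : α) : 0 ≤ law r A a :=
  Finset.sum_nonneg fun ω _ => by split_ifs; exacts [hr ω, le_rfl]

theorem law_mem_stdSimplex {r : Ω → ℝ} (hr : r ∈ stdSimplex ℝ Ω) (A : Ω → α) :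
    law r A ∈ stdSimplex ℝ α :=
  ⟨law_nonneg hr.1 A, by rw [sum_law, hr.2]⟩

omit [Fintype α] in
theorem le_law_apply {r : Ω → ℝ} (hr : ∀ ω, 0 ≤ r ω) (A : Ω → α) (ω : Ω) :
    r ω ≤ law r A (A ω) := by
  classical
  have := Finset.single_le_sum (f := fun ω' => if A ω' = A ω then r ω' else 0)
    (fun ω' _ => by split_ifs; exacts [hr ω', le_rfl]) (Finset.mem_univ ω)
  simpa [law] using this

theorem law_id (r : Ω → ℝ) (ω : Ω) : law r (fun ω => ω) ω = r ω := by
  classical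
  simp [law]

omit [Fintype β] in
theorem law_comp (r : Ω → ℝ) (A : Ω → α) (f : α → β) :
    law r (fun ω => f (A ω)) = law (law r A) f := by
  classical
  ext b
  have h := sum_law_mul r A (fun a => if f a = b then (1 : ℝ) else 0)
  simp only [mul_ite, mul_one, mul_zero] at h
  simpa [law] using h.symm

theorem law_fst (r : α × β → ℝ) (a : α) : law r Prod.fst a = ∑ b, r (a, b) := by
  classical
  simp only [law, Fintype.sum_prod_type]
  rw [Finset.sum_comm]
  simp

theorem law_snd (r : α × β → ℝ) (b : β) : law r Prod.snd b = ∑ a, r (a, b) := by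
  classical
  simp [law, Fintype.sum_prod_type]

omit [Fintype α] in
theorem sum_law_pair (r : Ω → ℝ) (A : Ω → α) (B : Ω → β) (a : α) :
    ∑ b, law r (fun ω => (A ω, B ω)) (a, b) = law r A a := by
  classical
  simp only [law, Prod.mk.injEq]
  rw [Finset.sum_comm]
  refine Finset.sum_congr rfl fun ω _ => ?_
  by_cases h : A ω = a <;> simp [h]

omit [Fintype β] in
theorem sum_law_pair' (r : Ω → ℝ) (A : Ω → α) (B : Ω → β) (b : β) :
    ∑ a, law r (fun ω => (A ω, B ω)) (a, b) = law r B b := by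
  classical
  simp only [law, Prod.mk.injEq]
  rw [Finset.sum_comm]
  refine Finset.sum_congr rfl fun ω _ => ?_
  by_cases h : B ω = b <;> simp [h]

omit [Fintype α] [Fintype β] in
/-- The probability of the observed value depends only on the partition a variable generates. -/
theorem law_apply_congr (r : Ω → ℝ) {A : Ω → α} {B : Ω → β}
    (h : ∀ ω ω', A ω = A ω' ↔ B ω = B ω') (ω : Ω) : law r A (A ω) = law r B (B ω) := by
  classical
  exact Finset.sum_congr rfl fun ω' _ => by simp [h ω' ω]

theorem entropy_eq_sum (r : Ω → ℝ) (A : Ω → α) :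
    entropy r A = -∑ ω, r ω * Real.logb 2 (law r A (A ω)) := by
  rw [← sum_law_mul r A (fun a => Real.logb 2 (law r A a)), ← Finset.sum_neg_distrib]
  exact Finset.sum_congr rfl fun a _ => by rw [Real.negMulLog, Real.logb]; ring

/-- Entropy sees only the partition generated by a variable. Variables of different types carrying
the same information can thus be exchanged without constructing bijections. -/
theorem entropy_congr (r : Ω → ℝ) {A : Ω → α} {B : Ω → β}
    (h : ∀ ω ω', A ω = A ω' ↔ B ω = B ω') : entropy r A = entropy r B := by
  rw [entropy_eq_sum, entropy_eq_sum]
  simp only [law_apply_congr r h]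

theorem entropy_comp (r : Ω → ℝ) (A : Ω → α) (f : α → β) :
    entropy r (fun ω => f (A ω)) = entropy (law r A) f := by
  simp only [entropy, law_comp]

theorem logb_two_le {x : ℝ} (hx : 0 < x) :
    Real.logb 2 x ≤ (x - 1) / Real.log 2 := by
  have := Real.log_le_sub_one_of_pos hx
  have h2 : 0 < Real.log 2 := Real.log_pos (by norm_num)
  rw [Real.logb]
  gcongr

/-- Gibbs' inequality. -/
theorem entropy_le_crossEntropy {r : Ω → ℝ} (hr : r ∈ stdSimplex ℝ Ω) (A : Ω → α)
    {q : α → ℝ} (hq : ∀ a, 0 ≤ q a) (hq1 : ∑ a, q a ≤ 1) (hpos : ∀ ω, 0 < r ω → 0 < q (A ω)) :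
    entropy r A ≤ -∑ ω, r ω * Real.logb 2 (q (A ω)) := by
  have h2 : 0 < Real.log 2 := Real.log_pos (by norm_num)
  rw [entropy_eq_sum, neg_le_neg_iff]
  have key : ∀ ω, r ω * Real.logb 2 (q (A ω)) ≤ r ω * Real.logb 2 (law r A (A ω))
      + (r ω * (q (A ω) / law r A (A ω)) - r ω) / Real.log 2 := by
    intro ω
    rcases (hr.1 ω).eq_or_lt with h | h
    · simp [← h]
    have hl : 0 < law r A (A ω) := h.trans_le (le_law_apply hr.1 A ω)
    have h1 := logb_two_le (div_pos (hpos ω h) hl)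
    rw [Real.logb_div (hpos ω h).ne' hl.ne'] at h1
    have h3 := mul_le_mul_of_nonneg_left h1 h.le
    have h4 : r ω * ((q (A ω) / law r A (A ω) - 1) / Real.log 2)
      = (r ω * (q (A ω) / law r A (A ω)) - r ω) / Real.log 2 := by ring
    linarith
  have h1 : ∑ ω, r ω * (q (A ω) / law r A (A ω)) ≤ 1 := by
    rw [← sum_law_mul r A (fun a => q a / law r A a)]
    refine le_trans (Finset.sum_le_sum fun a _ => ?_) hq1
    by_cases h : law r A a = 0
    · simpa [h] using hq a
    · rw [mul_div_cancel₀ _ h]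
  calc _ ≤ ∑ ω, (r ω * Real.logb 2 (law r A (A ω))
      + (r ω * (q (A ω) / law r A (A ω)) - r ω) / Real.log 2) :=
        Finset.sum_le_sum fun ω _ => key ω
    _ = ∑ ω, r ω * Real.logb 2 (law r A (A ω))
      + (∑ ω, r ω * (q (A ω) / law r A (A ω)) - ∑ ω, r ω) / Real.log 2 := by
        rw [Finset.sum_add_distrib, ← Finset.sum_div, Finset.sum_sub_distrib]
    _ ≤ _ := by
        rw [hr.2]
        have : (∑ ω, r ω * (q (A ω) / law r A (A ω)) - 1) / Real.log 2 ≤ 0 :=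
          div_nonpos_of_nonpos_of_nonneg (by linarith) h2.le
        linarith

/-- Gibbs' inequality against p(a,c)p(b,c)/p(c), the law that makes A and B conditionally
independent given C. This is I(A;B|C) ≥ 0, or: conditioning reduces entropy. -/
theorem entropy_submodular {r : Ω → ℝ} (hr : r ∈ stdSimplex ℝ Ω) (A : Ω → α) (B : Ω → β)
    (C : Ω → γ) :
    entropy r (fun ω => (A ω, B ω, C ω)) + entropy r C
      ≤ entropy r (fun ω => (A ω, C ω)) + entropy r (fun ω => (B ω, C ω)) := by
  have h := entropy_le_crossEntropy hr (fun ω => (A ω, B ω, C ω))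
    (q := fun z => law r (fun ω => (A ω, C ω)) (z.1, z.2.2) *
      law r (fun ω => (B ω, C ω)) z.2 / law r C z.2.2)
    (fun z => div_nonneg (mul_nonneg (law_nonneg hr.1 _ _) (law_nonneg hr.1 _ _))
      (law_nonneg hr.1 _ _)) ?_ ?_
  · have h1 : ∀ ω, r ω * Real.logb 2 (law r (fun ω => (A ω, C ω)) (A ω, C ω) *
        law r (fun ω => (B ω, C ω)) (B ω, C ω) / law r C (C ω))
        = r ω * Real.logb 2 (law r (fun ω => (A ω, C ω)) (A ω, C ω))
        + r ω * Real.logb 2 (law r (fun ω => (B ω, C ω)) (B ω, C ω))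
        - r ω * Real.logb 2 (law r C (C ω)) := by
      intro ω
      rcases (hr.1 ω).eq_or_lt with h | h
      · simp [← h]
      have l1 := (h.trans_le (le_law_apply hr.1 (fun ω => (A ω, C ω)) ω)).ne'
      have l2 := (h.trans_le (le_law_apply hr.1 (fun ω => (B ω, C ω)) ω)).ne'
      have l3 := (h.trans_le (le_law_apply hr.1 C ω)).ne'
      rw [Real.logb_div (mul_ne_zero l1 l2) l3, Real.logb_mul l1 l2]
      ring
    simp only [h1, Finset.sum_sub_distrib, Finset.sum_add_distrib] at h
    rw [entropy_eq_sum r C, entropy_eq_sum r (fun ω => (A ω, C ω)),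
      entropy_eq_sum r (fun ω => (B ω, C ω))]
    linarith
  · rw [Fintype.sum_prod_type]
    simp only [Fintype.sum_prod_type]
    rw [Finset.sum_comm]
    simp only [fun b => Finset.sum_comm (s := (Finset.univ : Finset α)) (t := (Finset.univ : Finset γ))
      (f := fun a c => law r (fun ω => (A ω, C ω)) (a, c) *
        law r (fun ω => (B ω, C ω)) (b, c) / law r C c)]
    simp only [← Finset.sum_div, ← Finset.sum_mul, sum_law_pair']
    rw [Finset.sum_comm]
    simp only [← Finset.sum_div, ← Finset.mul_sum, sum_law_pair']
    rw [← hr.2, ← sum_law r C]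
    exact Finset.sum_le_sum fun c _ => by
      by_cases h : law r C c = 0
      · simp [h]
      · rw [mul_div_cancel_right₀ _ h]
  · intro ω h
    have l1 := (h.trans_le (le_law_apply hr.1 (fun ω => (A ω, C ω)) ω))
    have l2 := (h.trans_le (le_law_apply hr.1 (fun ω => (B ω, C ω)) ω))
    have l3 := (h.trans_le (le_law_apply hr.1 C ω))
    exact div_pos (mul_pos l1 l2) l3

/-- Gibbs' inequality against the product of the coordinate laws. -/
theorem entropy_pi_le {n : ℕ} {r : Ω → ℝ} (hr : r ∈ stdSimplex ℝ Ω) (A : Ω → Fin n → α) :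
    entropy r A ≤ ∑ i, entropy r (fun ω => A ω i) := by
  classical
  have h := entropy_le_crossEntropy hr A (q := fun a => ∏ i, law r (fun ω => A ω i) (a i))
    (fun a => Finset.prod_nonneg fun i _ => law_nonneg hr.1 _ _) ?_
    (fun ω h => Finset.prod_pos fun i _ => h.trans_le (le_law_apply hr.1 (fun ω => A ω i) ω))
  · refine h.trans_eq ?_
    simp only [entropy_eq_sum, Finset.sum_neg_distrib]
    rw [Finset.sum_comm]
    congr 1
    refine Finset.sum_congr rfl fun ω _ => ?_
    rw [← Finset.mul_sum]
    rcases (hr.1 ω).eq_or_lt with h | h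
    · simp [← h]
    · rw [Real.logb_prod _ _
        fun i _ => (h.trans_le (le_law_apply hr.1 (fun ω => A ω i) ω)).ne']
  · rw [← Fintype.prod_sum (f := fun i a => law r (fun ω => A ω i) a)]
    simp [sum_law, hr.2]

/-- Fano's inequality. -/
theorem entropy_fano {r : Ω → ℝ} (hr : r ∈ stdSimplex ℝ Ω) {M : ℕ} (W : Ω → Fin M) (B : Ω → β)
    (d : β → Fin M) :
    entropy r (fun ω => (W ω, B ω)) - entropy r B
      ≤ 1 + (∑ ω, if d (B ω) ≠ W ω then r ω else 0) * Real.logb 2 M := by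
  classical
  have hne : Nonempty Ω := by
    by_contra h
    rw [not_nonempty_iff] at h
    simpa using hr.2
  have hM : 0 < M := (W hne.some).pos
  have hM' : (0 : ℝ) < M := by exact_mod_cast hM
  -- The reference law of W given B mixes, with weights 1/2, the point mass at the guess and the
  -- uniform law. It costs at most 1 bit when the guess is right and 1 + log M bits when it is
  -- wrong.
  have h := entropy_le_crossEntropy hr (fun ω => (W ω, B ω))
    (q := fun z => law r B z.2 * ((1 / 2) * (if d z.2 = z.1 then 1 else 0) + (1 / 2) * (1 / M)))
    ?_ ?_ ?_
  · refine (sub_le_sub_right h _).trans ?_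
    rw [entropy_eq_sum r B]
    have key : ∀ ω, r ω * Real.logb 2 (law r B (B ω)) - r ω
        - (if d (B ω) ≠ W ω then r ω else 0) * Real.logb 2 M
        ≤ r ω * Real.logb 2 (law r B (B ω) *
          ((1 / 2) * (if d (B ω) = W ω then 1 else 0) + (1 / 2) * (1 / M))) := by
      intro ω
      rcases (hr.1 ω).eq_or_lt with h | h
      · simp [← h]
      have l1 := (h.trans_le (le_law_apply hr.1 B ω)).ne'
      have hh : Real.logb 2 (1 / 2) = -1 := by
        rw [one_div, Real.logb_inv, Real.logb_self_eq_one (by norm_num)]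
      by_cases hd : d (B ω) = W ω
      · simp only [hd, if_true, ne_eq, not_true_eq_false, if_false, zero_mul, mul_one, sub_zero]
        rw [Real.logb_mul l1 (by positivity)]
        have : Real.logb 2 (1 / 2) ≤ Real.logb 2 (1 / 2 + 1 / 2 * (1 / (M : ℝ))) :=
          Real.logb_le_logb_of_le (by norm_num) (by norm_num) (by
            have : 0 < 1 / 2 * (1 / (M : ℝ)) := by positivity
            linarith)
        rw [hh] at this
        nlinarith
      · simp only [hd, if_false, ne_eq, not_false_eq_true, if_true, mul_zero, zero_add]
        rw [Real.logb_mul l1 (by positivity), Real.logb_mul (by norm_num) (by positivity), hh,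
          one_div (M : ℝ), Real.logb_inv]
        apply le_of_eq
        ring
    have := Finset.sum_le_sum fun ω (_ : ω ∈ Finset.univ) => key ω
    simp only [Finset.sum_sub_distrib, ← Finset.sum_mul] at this
    rw [hr.2] at this
    linarith
  · intro z
    exact mul_nonneg (law_nonneg hr.1 _ _) (by split_ifs <;> positivity)
  · rw [Fintype.sum_prod_type, Finset.sum_comm]
    simp only [← Finset.mul_sum, Finset.sum_add_distrib]
    simp only [Finset.sum_ite_eq, Finset.mem_univ, if_true, Finset.sum_const, Finset.card_univ,
      Fintype.card_fin, nsmul_eq_mul]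
    rw [mul_one_div_cancel hM'.ne', ← Finset.sum_mul, sum_law, hr.2]
    norm_num
  · intro ω h
    exact mul_pos (h.trans_le (le_law_apply hr.1 B ω)) (by split_ifs <;> positivity)

/-- The conditional entropy of `B` given `A` as an average over the values of `A`. -/
theorem entropy_pair_sub (r : Ω → ℝ) (A : Ω → α) (B : Ω → β)
    (c : α → β → ℝ) (hc : ∀ a, law r A a ≠ 0 → ∑ b, c a b = 1)
    (h : ∀ a b, law r (fun ω => (A ω, B ω)) (a, b) = law r A a * c a b) :
    entropy r (fun ω => (A ω, B ω)) - entropy r A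
      = ∑ a, law r A a * ∑ b, Real.negMulLog (c a b) / Real.log 2 := by
  simp only [entropy]
  rw [Fintype.sum_prod_type, ← Finset.sum_sub_distrib]
  refine Finset.sum_congr rfl fun a _ => ?_
  by_cases ha : law r A a = 0
  · simp [h, ha]
  simp only [h, Real.negMulLog_mul, add_div, Finset.sum_add_distrib]
  rw [← Finset.sum_div, ← Finset.sum_mul, hc a ha, ← Finset.sum_div, ← Finset.sum_div,
    ← Finset.mul_sum]
  ring

end Basics

end FinProb

/-- By Carathéodory's theorem at most dim E + 1 points are needed, so the hull is a finite union of
continuous images of the compact sets simplex × sᵐ. -/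
theorem IsCompact.convexHull_of_finiteDimensional {E : Type*} [NormedAddCommGroup E]
    [NormedSpace ℝ E] [FiniteDimensional ℝ E] {s : Set E} (hs : IsCompact s) :
    IsCompact (convexHull ℝ s) := by
  have h : convexHull ℝ s = ⋃ m ∈ Finset.range (Module.finrank ℝ E + 2),
      (fun z : (Fin m → ℝ) × (Fin m → E) => ∑ i, z.1 i • z.2 i) ''
        (stdSimplex ℝ (Fin m) ×ˢ Set.univ.pi fun _ => s) := by
    ext x
    simp only [Set.mem_iUnion, Finset.mem_range, Set.mem_image, Set.mem_prod, Set.mem_univ_pi,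
      exists_prop, Prod.exists]
    constructor
    · intro hx
      obtain ⟨ι, _, z, w, hz, hai, hw, hw1, hx⟩ := eq_pos_convex_span_of_mem_convexHull hx
      let e := Fintype.equivFin ι
      refine ⟨Fintype.card ι, ?_, fun i => w (e.symm i), fun i => z (e.symm i),
        ⟨⟨fun i => (hw _).le, ?_⟩, fun i => hz ⟨_, rfl⟩⟩, ?_⟩
      · have := hai.card_le_finrank_succ
        have h2 := Submodule.finrank_le (vectorSpan ℝ (Set.range z))
        omega
      · rw [← hw1]; exact e.symm.sum_comp w
      · rw [← hx]; exact e.symm.sum_comp fun i => w i • z i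
    · rintro ⟨m, -, w, z, ⟨hw, hz⟩, rfl⟩
      exact mem_convexHull_of_exists_fintype w z hw.1 hw.2 hz rfl
  rw [h]
  refine Finset.isCompact_biUnion _ fun m _ => ?_
  refine ((isCompact_stdSimplex ℝ (Fin m)).prod (isCompact_univ_pi fun _ => hs)).image ?_
  fun_prop

namespace FinProb

/-! ### Conditional entropies along a Markov chain A → B → C whose second step is a channel. -/

section Conditional

variable {Ω α β X Y : Type*} [Fintype Ω] [Fintype α] [Fintype β] [Fintype X] [Fintype Y]

theorem exists_disintegration {p : α × X → ℝ} (hp : p ∈ stdSimplex ℝ (α × X)) :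
    ∃ κ : α → X → ℝ, (∀ a, κ a ∈ stdSimplex ℝ X) ∧ ∀ a x, p (a, x) = law p Prod.fst a * κ a x := by
  classical
  -- On null values of a any distribution would do; the marginal on X is one that certainly exists.
  refine ⟨fun a => if law p Prod.fst a = 0 then law p Prod.snd else
    fun x => p (a, x) / law p Prod.fst a, fun a => ?_, fun a x => ?_⟩
  · by_cases h : law p Prod.fst a = 0
    · simp only [h, if_true]
      exact law_mem_stdSimplex hp _
    · simp only [h, if_false]
      refine ⟨fun x => div_nonneg (hp.1 _) (law_nonneg hp.1 _ _), ?_⟩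
      rw [← Finset.sum_div, ← law_fst, div_self h]
  · by_cases h : law p Prod.fst a = 0
    · have h' := h
      rw [law_fst, Finset.sum_eq_zero_iff_of_nonneg fun _ _ => hp.1 _] at h'
      simp [h, h' x (Finset.mem_univ x)]
    · simp only [h, if_false]
      rw [mul_div_cancel₀ _ h]

/-- The entropy of the output of the channel `W` with input distribution `p`. -/
def outEntropy (W : X → Y → ℝ) (p : X → ℝ) : ℝ :=
  ∑ y, Real.negMulLog (∑ x, p x * W x y) / Real.log 2

/-- The entropy of the output of the channel `W` given the input symbol `x`. -/
def rowEntropy (W : X → Y → ℝ) (x : X) : ℝ := ∑ y, Real.negMulLog (W x y) / Real.log 2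

/-- The mutual information between input and output of the channel `W`. -/
def channelInfo (W : X → Y → ℝ) (p : X → ℝ) : ℝ := outEntropy W p - ∑ x, p x * rowEntropy W x

@[fun_prop]
theorem continuous_outEntropy (W : X → Y → ℝ) : Continuous (outEntropy W) := by
  unfold outEntropy; fun_prop

@[fun_prop]
theorem continuous_channelInfo (W : X → Y → ℝ) : Continuous (channelInfo W) := by
  unfold channelInfo; fun_prop

theorem concaveOn_outEntropy {W : X → Y → ℝ} (hW : ∀ x y, 0 ≤ W x y) :
    ConcaveOn ℝ (stdSimplex ℝ X) (outEntropy W) := by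
  refine ⟨convex_stdSimplex ℝ X, fun p hp q hq a b ha hb hab => ?_⟩
  simp only [outEntropy, smul_eq_mul, Finset.mul_sum]
  rw [← Finset.sum_add_distrib]
  refine Finset.sum_le_sum fun y _ => ?_
  have h := Real.concaveOn_negMulLog.2
    (x := ∑ x, p x * W x y) (Finset.sum_nonneg fun x _ => mul_nonneg (hp.1 x) (hW x y))
    (y := ∑ x, q x * W x y) (Finset.sum_nonneg fun x _ => mul_nonneg (hq.1 x) (hW x y)) ha hb hab
  have h2 : ∑ x, (a • p + b • q) x * W x y
      = a • (∑ x, p x * W x y) + b • ∑ x, q x * W x y := by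
    simp only [smul_eq_mul, Finset.mul_sum, ← Finset.sum_add_distrib, Pi.add_apply, Pi.smul_apply]
    exact Finset.sum_congr rfl fun x _ => by ring
  rw [h2, ← mul_div_assoc, ← mul_div_assoc, ← add_div]
  exact div_le_div_of_nonneg_right h (Real.log_nonneg (by norm_num))

omit [Fintype α] [Fintype Y] in
theorem law_output {r : Ω → ℝ} {A : Ω → α} {B : Ω → X} {C : Ω → Y} {W : X → Y → ℝ}
    (h : ∀ a x y, law r (fun ω => (A ω, B ω, C ω)) (a, x, y)
      = law r (fun ω => (A ω, B ω)) (a, x) * W x y) (a : α) (y : Y) :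
    law r (fun ω => (A ω, C ω)) (a, y) = ∑ x, law r (fun ω => (A ω, B ω)) (a, x) * W x y := by
  classical
  simp only [← h]
  simp only [law, Prod.mk.injEq]
  rw [Finset.sum_comm]
  refine Finset.sum_congr rfl fun ω _ => ?_
  by_cases h1 : A ω = a <;> by_cases h2 : C ω = y <;> simp [h1, h2]

theorem condEntropy_output (r : Ω → ℝ) {A : Ω → α} {B : Ω → X} {C : Ω → Y}
    {W : X → Y → ℝ} (hW : ∀ x, ∑ y, W x y = 1) {κ : α → X → ℝ}
    (hκ : ∀ a, κ a ∈ stdSimplex ℝ X)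
    (h : ∀ a x y, law r (fun ω => (A ω, B ω, C ω)) (a, x, y)
      = law r (fun ω => (A ω, B ω)) (a, x) * W x y)
    (hAB : ∀ a x, law r (fun ω => (A ω, B ω)) (a, x) = law r A a * κ a x) :
    entropy r (fun ω => (A ω, C ω)) - entropy r A
      = ∑ a, law r A a * outEntropy W (κ a) := by
  refine entropy_pair_sub r A C (fun a y => ∑ x, κ a x * W x y) (fun a _ => ?_) fun a y => ?_
  · rw [Finset.sum_comm]
    simp only [← Finset.mul_sum, hW, mul_one]
    exact (hκ a).2
  · rw [law_output h, Finset.mul_sum]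
    exact Finset.sum_congr rfl fun x _ => by rw [hAB]; ring

/-- Once the input B is known, A says nothing more about the output, so only the law of B enters. -/
theorem condEntropy_input (r : Ω → ℝ) {A : Ω → α} {B : Ω → X} {C : Ω → Y}
    {W : X → Y → ℝ} (hW : ∀ x, ∑ y, W x y = 1)
    (h : ∀ a x y, law r (fun ω => (A ω, B ω, C ω)) (a, x, y)
      = law r (fun ω => (A ω, B ω)) (a, x) * W x y) :
    entropy r (fun ω => (A ω, B ω, C ω)) - entropy r (fun ω => (A ω, B ω))
      = ∑ x, law r B x * rowEntropy W x := by
  have h1 := entropy_pair_sub r (fun ω => (A ω, B ω)) C (fun z y => W z.2 y) (fun z _ => hW z.2)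
    (fun z y => by
      rw [← h]
      classical
      simp only [law, Prod.ext_iff, and_assoc])
  rw [entropy_congr r (A := fun ω => (A ω, B ω, C ω)) (B := fun ω => ((A ω, B ω), C ω))
    (by simp [and_assoc]), h1, Fintype.sum_prod_type, Finset.sum_comm]
  refine Finset.sum_congr rfl fun x _ => ?_
  dsimp only
  rw [← Finset.sum_mul, sum_law_pair', rowEntropy]

theorem entropy_output (r : Ω → ℝ) {B : Ω → X} {C : Ω → Y} {W : X → Y → ℝ}
    (h : ∀ x y, law r (fun ω => (B ω, C ω)) (x, y) = law r B x * W x y) :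
    entropy r C = outEntropy W (law r B) := by
  simp only [entropy, outEntropy]
  refine Finset.sum_congr rfl fun y _ => ?_
  rw [← sum_law_pair' r B C]
  simp only [h]

omit [Fintype X] [Fintype Y] in
theorem law_forget {r : Ω → ℝ} {A : Ω → α} {B : Ω → X} {C : Ω → Y} {W : X → Y → ℝ}
    (h : ∀ a x y, law r (fun ω => (A ω, B ω, C ω)) (a, x, y)
      = law r (fun ω => (A ω, B ω)) (a, x) * W x y) (x : X) (y : Y) :
    law r (fun ω => (B ω, C ω)) (x, y) = law r B x * W x y := by
  rw [← sum_law_pair' r A (fun ω => (B ω, C ω)), ← sum_law_pair' r A B, Finset.sum_mul]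
  exact Finset.sum_congr rfl fun a _ => h a x y

end Conditional

/-! ### The single-letter outer region as a set described by a convex hull. -/

section Hull

variable {X Y₁ Y₂ : Type*} [Fintype X] [Fintype Y₁] [Fintype Y₂]

/-- All triples `(p(x), H(Y₂|V), I(X;Y₁|V))` for finite-valued `V → X → (Y₁, Y₂)`. -/
def infoHull (W₁ : X → Y₁ → ℝ) (W₂ : X → Y₂ → ℝ) : Set ((X → ℝ) × ℝ × ℝ) :=
  convexHull ℝ ((fun p => (p, outEntropy W₂ p, channelInfo W₁ p)) '' stdSimplex ℝ X)

/-- All pairs dominated by `(I(V;Y₂), I(V;Y₂) + I(X;Y₁|V))` for some finite-valued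
`V → X → (Y₁, Y₂)`. -/
def sumRegion (W₁ : X → Y₁ → ℝ) (W₂ : X → Y₂ → ℝ) : Set (ℝ × ℝ) :=
  {R | ∃ k ∈ infoHull W₁ W₂, R.1 ≤ outEntropy W₂ k.1 - k.2.1 ∧
    R.2 ≤ outEntropy W₂ k.1 - k.2.1 + k.2.2}

theorem isCompact_infoHull (W₁ : X → Y₁ → ℝ) (W₂ : X → Y₂ → ℝ) :
    IsCompact (infoHull W₁ W₂) :=
  ((isCompact_stdSimplex ℝ X).image (by fun_prop)).convexHull_of_finiteDimensional

/-- The alphabet of V is unbounded, but only the point it defines in the compact hull matters. A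
convergent subsequence of such points preserves the two inequalities. -/
theorem isClosed_sumRegion (W₁ : X → Y₁ → ℝ) (W₂ : X → Y₂ → ℝ) :
    IsClosed (sumRegion W₁ W₂) := by
  refine IsSeqClosed.isClosed fun R R₀ hR hlim => ?_
  choose k hk h1 h2 using hR
  obtain ⟨k₀, hk₀, φ, hφ, hkφ⟩ := (isCompact_infoHull W₁ W₂).tendsto_subseq hk
  have hRφ := hlim.comp hφ.tendsto_atTop
  refine ⟨k₀, hk₀, ?_, ?_⟩
  · have hc : Continuous fun k : (X → ℝ) × ℝ × ℝ => outEntropy W₂ k.1 - k.2.1 := by fun_prop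
    exact le_of_tendsto_of_tendsto' ((continuous_fst.tendsto _).comp hRφ)
      ((hc.tendsto _).comp hkφ) fun n => h1 (φ n)
  · have hc : Continuous fun k : (X → ℝ) × ℝ × ℝ => outEntropy W₂ k.1 - k.2.1 + k.2.2 := by
      fun_prop
    exact le_of_tendsto_of_tendsto' ((continuous_snd.tendsto _).comp hRφ)
      ((hc.tendsto _).comp hkφ) fun n => h2 (φ n)

theorem fst_mem_of_mem_infoHull {W₁ : X → Y₁ → ℝ} {W₂ : X → Y₂ → ℝ} {k : (X → ℝ) × ℝ × ℝ}
    (hk : k ∈ infoHull W₁ W₂) : k.1 ∈ stdSimplex ℝ X := by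
  have h : infoHull W₁ W₂ ⊆ (LinearMap.fst ℝ (X → ℝ) (ℝ × ℝ)) ⁻¹' stdSimplex ℝ X :=
    convexHull_min (by rintro _ ⟨p, hp, rfl⟩; exact hp)
      ((convex_stdSimplex ℝ X).linear_preimage _)
  exact h hk

/-- Time sharing, with the sharing variable absorbed into V. The coordinates of the hull average
linearly, while H(Y₂) can only grow because `outEntropy` is concave. -/
theorem sum_mem_sumRegion {ι : Type*} [Fintype ι] {W₁ : X → Y₁ → ℝ} {W₂ : X → Y₂ → ℝ}
    (hW₂ : ∀ x y, 0 ≤ W₂ x y) {w : ι → ℝ} (hw : w ∈ stdSimplex ℝ ι)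
    {k : ι → (X → ℝ) × ℝ × ℝ} (hk : ∀ i, k i ∈ infoHull W₁ W₂) {a b : ℝ}
    (ha : a ≤ ∑ i, w i * (outEntropy W₂ (k i).1 - (k i).2.1))
    (hb : b ≤ ∑ i, w i * (outEntropy W₂ (k i).1 - (k i).2.1 + (k i).2.2)) :
    (a, b) ∈ sumRegion W₁ W₂ := by
  have hf : ∑ i, w i * outEntropy W₂ (k i).1 ≤ outEntropy W₂ (∑ i, w i • (k i).1) :=
    (concaveOn_outEntropy hW₂).le_map_sum (fun i _ => hw.1 i) hw.2
      fun i _ => fst_mem_of_mem_infoHull (hk i)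
  refine ⟨∑ i, w i • k i, (convex_convexHull ℝ _).sum_mem (fun i _ => hw.1 i) hw.2
    fun i _ => hk i, ?_, ?_⟩
  all_goals
    simp only [Prod.fst_sum, Prod.snd_sum, Prod.smul_fst, Prod.smul_snd, smul_eq_mul]
    simp only [mul_add, mul_sub, Finset.sum_add_distrib, Finset.sum_sub_distrib] at ha hb
    linarith

/-- The convex weights are the law of A and the points are the conditional laws of B given A = a;
all three coordinates are averages over a. -/
theorem mem_infoHull {Ω α : Type*} [Fintype Ω] [Fintype α] {W₁ : X → Y₁ → ℝ} {W₂ : X → Y₂ → ℝ}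
    (hW₁ : ∀ x, ∑ y, W₁ x y = 1) (hW₂ : ∀ x, ∑ y, W₂ x y = 1)
    {r : Ω → ℝ} (hr : r ∈ stdSimplex ℝ Ω) {A : Ω → α} {B : Ω → X} {C₁ : Ω → Y₁} {C₂ : Ω → Y₂}
    (h₁ : ∀ a x y, law r (fun ω => (A ω, B ω, C₁ ω)) (a, x, y)
      = law r (fun ω => (A ω, B ω)) (a, x) * W₁ x y)
    (h₂ : ∀ a x y, law r (fun ω => (A ω, B ω, C₂ ω)) (a, x, y)
      = law r (fun ω => (A ω, B ω)) (a, x) * W₂ x y) :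
    (law r B, entropy r (fun ω => (A ω, C₂ ω)) - entropy r A,
      entropy r (fun ω => (A ω, C₁ ω)) - entropy r A - ∑ x, law r B x * rowEntropy W₁ x)
      ∈ infoHull W₁ W₂ := by
  obtain ⟨κ, hκ, hAB⟩ := exists_disintegration (law_mem_stdSimplex hr fun ω => (A ω, B ω))
  have hfst : law (law r fun ω => (A ω, B ω)) Prod.fst = law r A := (law_comp r _ Prod.fst).symm
  rw [hfst] at hAB
  have hB : ∀ x, law r B x = ∑ a, law r A a * κ a x := fun x => by
    rw [← sum_law_pair' r A B]; simp only [hAB]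
  refine mem_convexHull_of_exists_fintype (law r A)
    (fun a => (κ a, outEntropy W₂ (κ a), channelInfo W₁ (κ a))) (law_nonneg hr.1 A)
    (law_mem_stdSimplex hr A).2 (fun a => ⟨κ a, hκ a, rfl⟩) ?_
  rw [condEntropy_output r hW₂ hκ h₂ hAB, condEntropy_output r hW₁ hκ h₁ hAB]
  refine Prod.ext ?_ (Prod.ext ?_ ?_)
  · ext x
    simp [Prod.fst_sum, Finset.sum_apply, hB]
  · simp [Prod.fst_sum, Prod.snd_sum]
  · simp only [Prod.snd_sum, Prod.smul_snd, smul_eq_mul, channelInfo, mul_sub,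
      Finset.sum_sub_distrib, hB, Finset.sum_mul, Finset.mul_sum]
    congr 1
    rw [Finset.sum_comm]
    exact Finset.sum_congr rfl fun x _ => Finset.sum_congr rfl fun a _ => by ring

end Hull

end FinProb

namespace BroadcastChannel

/-! ### From the convex hull to informations of the channel, and the use of sufficiency. -/

section Region

variable {X Y₁ Y₂ : Type*} [Fintype X] [Fintype Y₁] [Fintype Y₂]

/-- The channel to the first receiver. -/
def marginal₁ (ch : BroadcastChannel X Y₁ Y₂) (x : X) (y₁ : Y₁) : ℝ := ∑ y₂, ch.prob x (y₁, y₂)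

/-- The channel to the second receiver. -/
def marginal₂ (ch : BroadcastChannel X Y₁ Y₂) (x : X) (y₂ : Y₂) : ℝ := ∑ y₁, ch.prob x (y₁, y₂)

omit [Fintype X]

theorem marginal₁_nonneg (ch : BroadcastChannel X Y₁ Y₂) (x : X) (y : Y₁) :
    0 ≤ ch.marginal₁ x y := Finset.sum_nonneg fun _ _ => ch.nonneg _ _

theorem marginal₂_nonneg (ch : BroadcastChannel X Y₁ Y₂) (x : X) (y : Y₂) :
    0 ≤ ch.marginal₂ x y := Finset.sum_nonneg fun _ _ => ch.nonneg _ _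

theorem sum_marginal₁ (ch : BroadcastChannel X Y₁ Y₂) (x : X) : ∑ y, ch.marginal₁ x y = 1 := by
  rw [← ch.sum_eq_one x, Fintype.sum_prod_type]; rfl

theorem sum_marginal₂ (ch : BroadcastChannel X Y₁ Y₂) (x : X) : ∑ y, ch.marginal₂ x y = 1 := by
  rw [← ch.sum_eq_one x, Fintype.sum_prod_type_right]; rfl

theorem law_forget_output {Ω α : Type*} [Fintype Ω] {ch : BroadcastChannel X Y₁ Y₂} {r : Ω → ℝ}
    {A : Ω → α} {B : Ω → X} {C₁ : Ω → Y₁} {C₂ : Ω → Y₂}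
    (h : ∀ a x y, law r (fun ω => (A ω, B ω, C₁ ω, C₂ ω)) (a, x, y)
      = law r (fun ω => (A ω, B ω)) (a, x) * ch.prob x y) :
    (∀ a x y, law r (fun ω => (A ω, B ω, C₁ ω)) (a, x, y)
      = law r (fun ω => (A ω, B ω)) (a, x) * ch.marginal₁ x y) ∧
    ∀ a x y, law r (fun ω => (A ω, B ω, C₂ ω)) (a, x, y)
      = law r (fun ω => (A ω, B ω)) (a, x) * ch.marginal₂ x y := by
  classical
  constructor
  · intro a x y
    rw [marginal₁, Finset.mul_sum]
    simp only [← h]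
    rw [← sum_law_pair r (fun ω => (A ω, B ω, C₁ ω)) C₂]
    simp only [law, Prod.mk.injEq, and_assoc]
  · intro a x y
    rw [marginal₂, Finset.mul_sum]
    simp only [← h]
    rw [← sum_law_pair r (fun ω => (A ω, B ω, C₂ ω)) C₁]
    simp only [law, Prod.mk.injEq, and_assoc, and_comm, and_left_comm]

variable [Fintype X]

theorem joint_mem_stdSimplex (ch : BroadcastChannel X Y₁ Y₂) {S : Type*} [Fintype S]
    {p : S × X → ℝ} (hp : p ∈ stdSimplex ℝ (S × X)) :
    ch.joint p ∈ stdSimplex ℝ (S × X × Y₁ × Y₂) := by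
  refine ⟨fun ω => mul_nonneg (hp.1 _) (ch.nonneg _ _), ?_⟩
  rw [Fintype.sum_prod_type, ← hp.2, Fintype.sum_prod_type]
  refine Finset.sum_congr rfl fun s _ => ?_
  rw [Fintype.sum_prod_type]
  simp only [joint, ← Finset.mul_sum, ch.sum_eq_one, mul_one]

theorem law_joint_input (ch : BroadcastChannel X Y₁ Y₂) {S : Type*} [Fintype S]
    (p : S × X → ℝ) (s : S) (x : X) :
    law (ch.joint p) (fun ω => (ω.1, ω.2.1)) (s, x) = p (s, x) := by
  classical
  have h := sum_law_pair (ch.joint p) (fun ω => (ω.1, ω.2.1)) (fun ω => ω.2.2) (s, x)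
  rw [← h]
  have h2 : ∀ y, law (ch.joint p) (fun ω => ((ω.1, ω.2.1), ω.2.2)) ((s, x), y)
      = ch.joint p (s, x, y) := by
    intro y
    have : ∀ ω : S × X × Y₁ × Y₂, ((ω.1, ω.2.1), ω.2.2) = ((s, x), y) ↔ ω = (s, x, y) := by
      simp [Prod.ext_iff, and_assoc]
    simp only [law, this, Finset.sum_ite_eq', Finset.mem_univ, if_true]
  simp only [h2, joint, ← Finset.mul_sum, ch.sum_eq_one, mul_one]

theorem law_joint (ch : BroadcastChannel X Y₁ Y₂) {S : Type*} [Fintype S]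
    (p : S × X → ℝ) (s : S) (x : X) (y : Y₁ × Y₂) :
    law (ch.joint p) (fun ω => (ω.1, ω.2.1, ω.2.2.1, ω.2.2.2)) (s, x, y)
      = law (ch.joint p) (fun ω => (ω.1, ω.2.1)) (s, x) * ch.prob x y := by
  rw [law_joint_input]
  exact law_id (ch.joint p) (s, x, y)

theorem law_joint_fst (ch : BroadcastChannel X Y₁ Y₂) {S : Type*} [Fintype S]
    (p : S × X → ℝ) : law (ch.joint p) (fun ω => ω.1) = law p Prod.fst := by
  ext s
  rw [law_fst p, ← sum_law_pair (ch.joint p) (fun ω => ω.1) (fun ω => ω.2.1)]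
  simp only [law_joint_input]

theorem law_joint_snd (ch : BroadcastChannel X Y₁ Y₂) {S : Type*} [Fintype S]
    (p : S × X → ℝ) : law (ch.joint p) (fun ω => ω.2.1) = law p Prod.snd := by
  ext x
  rw [law_snd, ← sum_law_pair' (ch.joint p) (fun ω => ω.1) (fun ω => ω.2.1)]
  simp only [law_joint_input]

theorem infoAux₂_eq (ch : BroadcastChannel X Y₁ Y₂) {S : Type*} [Fintype S] (p : S × X → ℝ) :
    ch.infoAux₂ p id = outEntropy ch.marginal₂ (law p Prod.snd)
      - (entropy (ch.joint p) (fun ω => (ω.1, ω.2.2.2)) - entropy (ch.joint p) (fun ω => ω.1)) := by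
  have h := entropy_output (ch.joint p) (law_forget (law_forget_output (ch.law_joint p)).2)
  rw [law_joint_snd] at h
  simp only [infoAux₂, mutualInfo, id, ← h]
  ring

theorem infoInputGiven₁_eq (ch : BroadcastChannel X Y₁ Y₂) {S : Type*} [Fintype S]
    (p : S × X → ℝ) :
    ch.infoInputGiven₁ p id = entropy (ch.joint p) (fun ω => (ω.1, ω.2.2.1))
      - entropy (ch.joint p) (fun ω => ω.1)
      - ∑ x, law p Prod.snd x * rowEntropy ch.marginal₁ x := by
  have h := condEntropy_input (ch.joint p) ch.sum_marginal₁ (law_forget_output (ch.law_joint p)).1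
  rw [law_joint_snd] at h
  rw [← h]
  simp only [infoInputGiven₁, condMutualInfo, id]
  rw [entropy_congr (ch.joint p) (A := fun ω => (ω.2.1, ω.1)) (B := fun ω => (ω.1, ω.2.1))
      (by simp [and_comm]),
    entropy_congr (ch.joint p) (A := fun ω => (ω.2.2.1, ω.1)) (B := fun ω => (ω.1, ω.2.2.1))
      (by simp [and_comm]),
    entropy_congr (ch.joint p) (A := fun ω => (ω.2.1, ω.2.2.1, ω.1))
      (B := fun ω => (ω.1, ω.2.1, ω.2.2.1)) (by simp only [Prod.mk.injEq]; tauto)]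
  ring

/-- Every point of the hull comes from an auxiliary variable: its law is given by the convex
weights, and the conditional input laws are the points being averaged. -/
theorem exists_of_mem_infoHull (ch : BroadcastChannel X Y₁ Y₂) {k : (X → ℝ) × ℝ × ℝ}
    (hk : k ∈ infoHull ch.marginal₁ ch.marginal₂) :
    ∃ (n : ℕ) (p : Fin n × X → ℝ), p ∈ stdSimplex ℝ (Fin n × X) ∧
      ch.infoAux₂ p id = outEntropy ch.marginal₂ k.1 - k.2.1 ∧
      ch.infoInputGiven₁ p id = k.2.2 := by
  obtain ⟨ι, _, w, z, hw, hw1, hz, rfl⟩ := mem_convexHull_iff_exists_fintype.1 hk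
  choose π hπ hz using hz
  obtain rfl : (fun i => (π i, outEntropy ch.marginal₂ (π i), channelInfo ch.marginal₁ (π i))) = z :=
    funext hz
  let e := Fintype.equivFin ι
  let p : Fin (Fintype.card ι) × X → ℝ := fun a => w (e.symm a.1) * π (e.symm a.1) a.2
  have hfst : ∀ i, law p Prod.fst i = w (e.symm i) := fun i => by
    rw [law_fst]
    simp only [p, ← Finset.mul_sum, (hπ _).2, mul_one]
  have hsnd : law p Prod.snd = ∑ i, w i • π i := by
    ext x
    rw [law_snd, Finset.sum_apply]
    exact e.symm.sum_comp fun i => w i * π i x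
  have hp : p ∈ stdSimplex ℝ (Fin (Fintype.card ι) × X) := by
    refine ⟨fun a => mul_nonneg (hw _) ((hπ _).1 _), ?_⟩
    rw [Fintype.sum_prod_type]
    simp only [p, ← Finset.mul_sum, (hπ _).2, mul_one]
    rw [← hw1]
    exact e.symm.sum_comp w
  have hAB : ∀ a x, law (ch.joint p) (fun ω => (ω.1, ω.2.1)) (a, x)
      = law (ch.joint p) (fun ω => ω.1) a * π (e.symm a) x := fun a x => by
    rw [law_joint_input, law_joint_fst, hfst]
  have h1 := condEntropy_output (ch.joint p) ch.sum_marginal₁ (fun a => hπ (e.symm a))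
    (law_forget_output (ch.law_joint p)).1 hAB
  have h2 := condEntropy_output (ch.joint p) ch.sum_marginal₂ (fun a => hπ (e.symm a))
    (law_forget_output (ch.law_joint p)).2 hAB
  simp only [law_joint_fst, hfst] at h1 h2
  rw [e.symm.sum_comp fun i => w i * outEntropy ch.marginal₁ (π i)] at h1
  rw [e.symm.sum_comp fun i => w i * outEntropy ch.marginal₂ (π i)] at h2
  refine ⟨_, p, hp, ?_, ?_⟩
  · rw [infoAux₂_eq, h2, hsnd]
    simp [Prod.fst_sum, Prod.snd_sum]
  · rw [infoInputGiven₁_eq, h1, hsnd]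
    simp only [Prod.snd_sum, Prod.smul_snd, smul_eq_mul, channelInfo, mul_sub,
      Finset.sum_sub_distrib, Finset.sum_apply, Pi.smul_apply, Finset.sum_mul, Finset.mul_sum]
    congr 1
    rw [Finset.sum_comm]
    exact Finset.sum_congr rfl fun x _ => Finset.sum_congr rfl fun a _ => by ring

section Relabel

variable {S T T' : Type*} [Fintype S] [Fintype T] [Fintype T']

omit [Fintype T] in
theorem joint_law (ch : BroadcastChannel X Y₁ Y₂) (p : S × X → ℝ) (A : S → T) :
    ch.joint (law p fun z => (A z.1, z.2)) = law (ch.joint p) fun ω => (A ω.1, ω.2) := by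
  classical
  ext ⟨t, x, y⟩
  simp only [joint, law]
  rw [Fintype.sum_prod_type, Fintype.sum_prod_type, Finset.sum_mul]
  refine Finset.sum_congr rfl fun s _ => ?_
  by_cases h : A s = t
  · simp only [h, Prod.mk.injEq, true_and, Finset.sum_ite_eq', Finset.mem_univ, if_true]
  · simp [h]

theorem infoAux₂_comp (ch : BroadcastChannel X Y₁ Y₂) (p : S × X → ℝ) (A : S → T) (B : T → T') :
    ch.infoAux₂ (law p fun z => (A z.1, z.2)) B = ch.infoAux₂ p (fun s => B (A s)) := by
  simp only [infoAux₂, mutualInfo, joint_law, ← entropy_comp]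

theorem infoInputGiven₁_comp (ch : BroadcastChannel X Y₁ Y₂) (p : S × X → ℝ) (A : S → T)
    (B : T → T') :
    ch.infoInputGiven₁ (law p fun z => (A z.1, z.2)) B
      = ch.infoInputGiven₁ p (fun s => B (A s)) := by
  simp only [infoInputGiven₁, condMutualInfo, joint_law, ← entropy_comp]

end Relabel

/-- The only use of sufficiency. It is applied with a constant V, and of the dominating law only its
U is kept: both bounds increase with I(U;Y₂) and I(X;Y₁|U). -/
theorem mem_superpositionRegion_of_mem_sumRegion {ch : BroadcastChannel X Y₁ Y₂}
    {P : Set (X → ℝ)} (hP : ch.IsSufficientClass P) {R : ℝ × ℝ} (h1 : 0 ≤ R.1) (h2 : 0 ≤ R.2)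
    (hR : (R.2, R.1 + R.2) ∈ sumRegion ch.marginal₁ ch.marginal₂) :
    R ∈ ch.superpositionRegion P := by
  obtain ⟨k, hk, hR2, hR12⟩ := hR
  obtain ⟨n, p, hp, hp2, hp1⟩ := ch.exists_of_mem_infoHull hk
  dsimp only at hR2 hR12
  rw [← hp2] at hR2
  rw [← hp2, ← hp1] at hR12
  obtain ⟨k', l', q, hq, hqP, -, hq2, -, -, hq1, -⟩ := hP.2 n 1
    (law p fun z => ((fun u => (u, (0 : Fin 1))) z.1, z.2)) (law_mem_stdSimplex hp _)
  rw [infoAux₂_comp ch p (fun u => (u, (0 : Fin 1))) Prod.fst] at hq2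
  rw [infoInputGiven₁_comp ch p (fun u => (u, (0 : Fin 1))) Prod.fst] at hq1
  refine ⟨h1, h2, k', law q fun z => (Prod.fst z.1, z.2), law_mem_stdSimplex hq _, ?_, ?_, ?_⟩
  · rw [← law_comp]
    exact hqP
  · rw [infoAux₂_comp ch q Prod.fst id]
    exact hR2.trans hq2
  · rw [infoAux₂_comp ch q Prod.fst id, infoInputGiven₁_comp ch q Prod.fst id]
    exact hR12.trans (add_le_add hq2 hq1)

end Region

end BroadcastChannel

namespace FinProb

/-! ### The Csiszár sum identity and chain rules, by telescoping. -/

section Hybrid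

variable {Ω τ Y Z : Type*} {n : ℕ}

/-- The variable `T` with the first `i` coordinates of `B` and the last `n - i` coordinates
of `C`. -/
def hybrid (T : Ω → τ) (B : Ω → Fin n → Y) (C : Ω → Fin n → Z) (i : ℕ) (ω : Ω) :
    τ × (Fin n → Y ⊕ Z) :=
  (T ω, fun j => if (j : ℕ) < i then Sum.inl (B ω j) else Sum.inr (C ω j))

/-- The variable `T` with the first `i` coordinates of `B` and the last `n - i - 1` coordinates
of `C`. -/
def punctured (T : Ω → τ) (B : Ω → Fin n → Y) (C : Ω → Fin n → Z) (i : ℕ) (ω : Ω) :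
    τ × (Fin n → Option (Y ⊕ Z)) :=
  (T ω, fun j => if (j : ℕ) < i then some (Sum.inl (B ω j))
    else if (j : ℕ) = i then none else some (Sum.inr (C ω j)))

/-- The variable `T` with the last `n - i` coordinates of `C`. -/
def suffix (T : Ω → τ) (C : Ω → Fin n → Z) (i : ℕ) (ω : Ω) : τ × (Fin n → Option Z) :=
  (T ω, fun j => if (j : ℕ) < i then none else some (C ω j))

/-- The variable `T` with the first `i` coordinates of `B`. -/
def initial (T : Ω → τ) (B : Ω → Fin n → Y) (i : ℕ) (ω : Ω) : τ × (Fin n → Option Y) :=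
  (T ω, fun j => if (j : ℕ) < i then some (B ω j) else none)

variable {T : Ω → τ} {B : Ω → Fin n → Y} {C : Ω → Fin n → Z}

/-- Masking coordinates, rather than truncating tuples, gives these variables a type independent of
i. This description of the generated partition is then all that `entropy_congr` needs. -/
theorem hybrid_eq_iff (i : ℕ) (ω ω' : Ω) : hybrid T B C i ω = hybrid T B C i ω' ↔
    T ω = T ω' ∧ ∀ j : Fin n, ((j : ℕ) < i → B ω j = B ω' j) ∧ (i ≤ (j : ℕ) → C ω j = C ω' j) := by
  simp only [hybrid, Prod.mk.injEq, funext_iff]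
  refine and_congr_right fun _ => forall_congr' fun j => ?_
  rcases lt_or_ge (j : ℕ) i with h | h
  · simp [h]
  · simp [h, not_lt.2 h]

theorem punctured_eq_iff (i : ℕ) (ω ω' : Ω) : punctured T B C i ω = punctured T B C i ω' ↔
    T ω = T ω' ∧ ∀ j : Fin n, ((j : ℕ) < i → B ω j = B ω' j) ∧ (i < (j : ℕ) → C ω j = C ω' j) := by
  simp only [punctured, Prod.mk.injEq, funext_iff]
  refine and_congr_right fun _ => forall_congr' fun j => ?_
  rcases lt_trichotomy (j : ℕ) i with h | h | h
  · simp [h, h.not_gt]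
  · simp [h]
  · simp [h, h.not_gt, h.ne']

theorem suffix_eq_iff (i : ℕ) (ω ω' : Ω) : suffix T C i ω = suffix T C i ω' ↔
    T ω = T ω' ∧ ∀ j : Fin n, i ≤ (j : ℕ) → C ω j = C ω' j := by
  simp only [suffix, Prod.mk.injEq, funext_iff]
  refine and_congr_right fun _ => forall_congr' fun j => ?_
  rcases lt_or_ge (j : ℕ) i with h | h
  · simp [h]
  · simp [h, not_lt.2 h]

theorem initial_eq_iff (i : ℕ) (ω ω' : Ω) : initial T B i ω = initial T B i ω' ↔
    T ω = T ω' ∧ ∀ j : Fin n, (j : ℕ) < i → B ω j = B ω' j := by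
  simp only [initial, Prod.mk.injEq, funext_iff]
  refine and_congr_right fun _ => forall_congr' fun j => ?_
  rcases lt_or_ge (j : ℕ) i with h | h
  · simp [h]
  · simp [not_lt.2 h]

variable [Fintype Ω] [Fintype τ] [Fintype Y] [Fintype Z] (r : Ω → ℝ)
variable (T B C)

theorem entropy_hybrid_zero :
    entropy r (hybrid T B C 0) = entropy r (fun ω => (T ω, C ω)) :=
  entropy_congr r fun ω ω' => by rw [hybrid_eq_iff]; simp [funext_iff]

theorem entropy_hybrid_length :
    entropy r (hybrid T B C n) = entropy r (fun ω => (T ω, B ω)) :=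
  entropy_congr r fun ω ω' => by
    rw [hybrid_eq_iff, Prod.mk.injEq, funext_iff]
    refine and_congr_right fun _ => forall_congr' fun j => ?_
    simp

theorem entropy_punctured_snd (i : Fin n) :
    entropy r (fun ω => (punctured T B C i ω, C ω i)) = entropy r (hybrid T B C i) :=
  entropy_congr r fun ω ω' => by
    rw [hybrid_eq_iff, Prod.mk.injEq, punctured_eq_iff]
    constructor
    · rintro ⟨⟨h1, h2⟩, h3⟩
      refine ⟨h1, fun j => ⟨(h2 j).1, fun h => ?_⟩⟩
      rcases h.eq_or_lt with h | h
      · obtain rfl := Fin.ext h; exact h3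
      · exact (h2 j).2 h
    · rintro ⟨h1, h2⟩
      exact ⟨⟨h1, fun j => ⟨(h2 j).1, fun h => (h2 j).2 h.le⟩⟩, (h2 i).2 le_rfl⟩

theorem entropy_punctured_fst (i : Fin n) :
    entropy r (fun ω => (punctured T B C i ω, B ω i)) = entropy r (hybrid T B C (i + 1)) :=
  entropy_congr r fun ω ω' => by
    rw [hybrid_eq_iff, Prod.mk.injEq, punctured_eq_iff]
    constructor
    · rintro ⟨⟨h1, h2⟩, h3⟩
      refine ⟨h1, fun j => ⟨fun h => ?_, (h2 j).2⟩⟩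
      rcases (Nat.lt_succ_iff.1 h).eq_or_lt with h | h
      · obtain rfl := Fin.ext h; exact h3
      · exact (h2 j).1 h
    · rintro ⟨h1, h2⟩
      exact ⟨⟨h1, fun j => ⟨fun h => (h2 j).1 (h.trans (Nat.lt_succ_self _)), (h2 j).2⟩⟩,
        (h2 i).1 (Nat.lt_succ_self _)⟩

/-- The Csiszár sum identity. -/
theorem sum_entropy_punctured_sub :
    ∑ i : Fin n, (entropy r (fun ω => (punctured T B C i ω, B ω i))
      - entropy r (fun ω => (punctured T B C i ω, C ω i)))
      = entropy r (fun ω => (T ω, B ω)) - entropy r (fun ω => (T ω, C ω)) := by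
  -- Filling the gap at i with B gives the hybrid at i + 1, filling it with C the hybrid at i, so
  -- the sum telescopes.
  simp only [entropy_punctured_fst, entropy_punctured_snd]
  rw [Fin.sum_univ_eq_sum_range
    (fun i => entropy r (hybrid T B C (i + 1)) - entropy r (hybrid T B C i)),
    Finset.sum_range_sub (fun i => entropy r (hybrid T B C i)), entropy_hybrid_zero, entropy_hybrid_length]

theorem entropy_suffix_zero : entropy r (suffix T C 0) = entropy r (fun ω => (T ω, C ω)) :=
  entropy_congr r fun ω ω' => by rw [suffix_eq_iff]; simp [funext_iff]

theorem entropy_suffix_length : entropy r (suffix T C n) = entropy r T :=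
  entropy_congr r fun ω ω' => by
    rw [suffix_eq_iff]
    exact and_iff_left fun j h => absurd j.2 (not_lt.2 h)

/-- The chain rule for H(C|T), read from the last coordinate: the i-th term conditions on T and the
later C's, and conditioning also on the earlier B's only lowers it. -/
theorem sum_condEntropy_punctured_le (hr : r ∈ stdSimplex ℝ Ω) :
    ∑ i : Fin n, (entropy r (fun ω => (punctured T B C i ω, C ω i))
      - entropy r (punctured T B C i)) ≤ entropy r (fun ω => (T ω, C ω)) - entropy r T := by
  have key : ∀ i : Fin n, entropy r (fun ω => (punctured T B C i ω, C ω i))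
      - entropy r (punctured T B C i) ≤ entropy r (suffix T C i) - entropy r (suffix T C (i + 1)) := by
    intro i
    have h := entropy_submodular hr (fun ω => C ω i) (punctured T B C i) (suffix T C (i + 1))
    have h1 : entropy r (fun ω => (C ω i, punctured T B C i ω, suffix T C (i + 1) ω))
        = entropy r (fun ω => (punctured T B C i ω, C ω i)) :=
      entropy_congr r fun ω ω' => by
        simp only [Prod.mk.injEq, punctured_eq_iff, suffix_eq_iff]
        exact ⟨fun h => ⟨h.2.1, h.1⟩, fun h => ⟨h.2, h.1, h.1.1, fun j => (h.1.2 j).2⟩⟩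
    have h2 : entropy r (fun ω => (punctured T B C i ω, suffix T C (i + 1) ω))
        = entropy r (punctured T B C i) :=
      entropy_congr r fun ω ω' => by
        simp only [Prod.mk.injEq, punctured_eq_iff, suffix_eq_iff]
        exact ⟨fun h => h.1, fun h => ⟨h, h.1, fun j => (h.2 j).2⟩⟩
    have h3 : entropy r (fun ω => (C ω i, suffix T C (i + 1) ω)) = entropy r (suffix T C i) :=
      entropy_congr r fun ω ω' => by
        simp only [Prod.mk.injEq, suffix_eq_iff]
        constructor
        · rintro ⟨h1, h2, h3⟩
          refine ⟨h2, fun j h => ?_⟩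
          rcases h.eq_or_lt with h | h
          · obtain rfl := Fin.ext h; exact h1
          · exact h3 j h
        · rintro ⟨h1, h2⟩
          exact ⟨h2 i le_rfl, h1, fun j h => h2 j (Nat.le_of_succ_le h)⟩
    rw [h1, h2, h3] at h
    linarith
  refine (Finset.sum_le_sum fun i _ => key i).trans_eq ?_
  rw [Fin.sum_univ_eq_sum_range
    (fun i => entropy r (suffix T C i) - entropy r (suffix T C (i + 1))),
    Finset.sum_range_sub', entropy_suffix_zero, entropy_suffix_length]

/-- The chain rule for H(B|T). Since D is a function of T, inserting D_i changes nothing; it is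
there so that, with T the messages and D the codeword, each term becomes the noise entropy of one
channel use. -/
theorem sum_condEntropy_initial {X : Type*} [Fintype X] (D : Ω → Fin n → X)
    (hD : ∀ ω ω', T ω = T ω' → D ω = D ω') :
    ∑ i : Fin n, (entropy r (fun ω => (initial T B i ω, D ω i, B ω i))
      - entropy r (fun ω => (initial T B i ω, D ω i)))
      = entropy r (fun ω => (T ω, B ω)) - entropy r T := by
  have h1 : ∀ i : Fin n, entropy r (fun ω => (initial T B i ω, D ω i, B ω i))
      = entropy r (initial T B (i + 1)) := fun i =>
    entropy_congr r fun ω ω' => by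
      simp only [Prod.mk.injEq, initial_eq_iff]
      constructor
      · rintro ⟨⟨h1, h2⟩, -, h3⟩
        refine ⟨h1, fun j h => ?_⟩
        rcases (Nat.lt_succ_iff.1 h).eq_or_lt with h | h
        · obtain rfl := Fin.ext h; exact h3
        · exact h2 j h
      · rintro ⟨h1, h2⟩
        exact ⟨⟨h1, fun j h => h2 j (h.trans (Nat.lt_succ_self _))⟩,
          congrFun (hD _ _ h1) i, h2 i (Nat.lt_succ_self _)⟩
  have h2 : ∀ i : Fin n, entropy r (fun ω => (initial T B i ω, D ω i))
      = entropy r (initial T B i) := fun i =>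
    entropy_congr r fun ω ω' => by
      simp only [Prod.mk.injEq, initial_eq_iff]
      exact ⟨fun h => h.1, fun h => ⟨h, congrFun (hD _ _ h.1) i⟩⟩
  simp only [h1, h2]
  rw [Fin.sum_univ_eq_sum_range
    (fun i => entropy r (initial T B (i + 1)) - entropy r (initial T B i)),
    Finset.sum_range_sub (fun i => entropy r (initial T B i))]
  congr 1
  · exact entropy_congr r fun ω ω' => by rw [initial_eq_iff]; simp [funext_iff]
  · exact entropy_congr r fun ω ω' => by rw [initial_eq_iff]; simp

end Hybrid

theorem entropy_of_uniform {Ω α : Type*} [Fintype Ω] [Fintype α] (r : Ω → ℝ) (A : Ω → α)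
    (h : ∀ a, law r A a = 1 / Fintype.card α) (hα : 0 < Fintype.card α) :
    entropy r A = Real.logb 2 (Fintype.card α) := by
  have : (Fintype.card α : ℝ) ≠ 0 := by exact_mod_cast hα.ne'
  simp only [entropy, h, Finset.sum_const, Finset.card_univ, nsmul_eq_mul, Real.negMulLog,
    Real.logb, one_div, Real.log_inv]
  field_simp

/-- In a product distribution a coordinate is independent of the others. -/
theorem sum_prod_mul_ite {n : ℕ} {Y : Type*} [Fintype Y] [DecidableEq Y] (W : Fin n → Y → ℝ)
    (i : Fin n) (hW : ∑ b, W i b = 1) (g : (Fin n → Y) → ℝ)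
    (hg : ∀ y y', (∀ j, j ≠ i → y j = y' j) → g y = g y') (b : Y) :
    (∑ y : Fin n → Y, if y i = b then (∏ j, W j (y j)) * g y else 0)
      = (∑ y : Fin n → Y, (∏ j, W j (y j)) * g y) * W i b := by
  obtain _ | m := n
  · exact i.elim0
  rw [← (Fin.insertNthEquiv (fun _ => Y) i).sum_comp, ← (Fin.insertNthEquiv (fun _ => Y) i).sum_comp,
    Fintype.sum_prod_type_right, Fintype.sum_prod_type_right, Finset.sum_mul]
  refine Finset.sum_congr rfl fun y _ => ?_
  obtain ⟨G, hG⟩ : ∃ G, ∀ a, g (Fin.insertNthEquiv (fun _ => Y) i (a, y)) = G :=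
    ⟨g (Fin.insertNthEquiv (fun _ => Y) i (b, y)), fun a => hg _ _ fun j hj => by
      obtain ⟨k, rfl⟩ := Fin.exists_succAbove_eq hj
      simp⟩
  simp only [hG, Fin.insertNthEquiv_apply, Fin.prod_univ_succAbove _ i, Fin.insertNth_apply_same,
    Fin.insertNth_apply_succAbove, Finset.sum_ite_eq', Finset.mem_univ, if_true]
  simp only [← Finset.sum_mul, hW]
  ring

end FinProb

/-! ### The converse for a single code. -/

namespace BroadcastCode

variable {X Y₁ Y₂ : Type*} [Fintype Y₁] [Fintype Y₂] {M₁ M₂ n : ℕ}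

/-- The joint distribution of the messages and the outputs when the code is used. -/
def blockLaw (c : BroadcastCode X Y₁ Y₂ M₁ M₂ n) (ch : BroadcastChannel X Y₁ Y₂) :
    (Fin M₁ × Fin M₂) × (Fin n → Y₁ × Y₂) → ℝ :=
  fun ω => 1 / ((M₁ : ℝ) * M₂) * ∏ i, ch.prob (c.enc ω.1 i) (ω.2 i)

variable (c : BroadcastCode X Y₁ Y₂ M₁ M₂ n) (ch : BroadcastChannel X Y₁ Y₂)

theorem sum_prod_prob {X Y₁ Y₂ : Type*} [Fintype Y₁] [Fintype Y₂] {n : ℕ}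
    (ch : BroadcastChannel X Y₁ Y₂) (x : Fin n → X) :
    ∑ y : Fin n → Y₁ × Y₂, ∏ i, ch.prob (x i) (y i) = 1 := by
  rw [← Fintype.prod_sum (f := fun i y => ch.prob (x i) y)]
  simp [ch.sum_eq_one]

theorem sum_blockLaw (w : Fin M₁ × Fin M₂) :
    ∑ y, c.blockLaw ch (w, y) = 1 / ((M₁ : ℝ) * M₂) := by
  simp only [blockLaw, ← Finset.mul_sum, sum_prod_prob, mul_one]

theorem blockLaw_mem_stdSimplex (h₁ : 0 < M₁) (h₂ : 0 < M₂) :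
    c.blockLaw ch ∈ stdSimplex ℝ ((Fin M₁ × Fin M₂) × (Fin n → Y₁ × Y₂)) := by
  refine ⟨fun ω => mul_nonneg (by positivity) (Finset.prod_nonneg fun i _ => ch.nonneg _ _), ?_⟩
  rw [Fintype.sum_prod_type]
  simp only [sum_blockLaw, Finset.sum_const, Finset.card_univ, Fintype.card_prod, Fintype.card_fin,
    nsmul_eq_mul]
  have : (M₁ : ℝ) ≠ 0 := by exact_mod_cast h₁.ne'
  have : (M₂ : ℝ) ≠ 0 := by exact_mod_cast h₂.ne'
  push_cast
  field_simp

theorem law_blockLaw_messages (w : Fin M₁ × Fin M₂) :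
    law (c.blockLaw ch) (fun ω => ω.1) w = 1 / ((M₁ : ℝ) * M₂) := by
  rw [← sum_blockLaw c ch w]
  exact law_fst _ w

theorem law_blockLaw_snd (h₁ : 0 < M₁) (w : Fin M₂) :
    law (c.blockLaw ch) (fun ω => ω.1.2) w = 1 / (M₂ : ℝ) := by
  rw [law_comp (c.blockLaw ch) (fun ω => ω.1) Prod.snd, law_snd]
  simp only [law_blockLaw_messages, Finset.sum_const, Finset.card_univ, Fintype.card_fin,
    nsmul_eq_mul]
  have : (M₁ : ℝ) ≠ 0 := by exact_mod_cast h₁.ne'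
  field_simp

/-- The channel is memoryless. -/
theorem law_blockLaw_markov {α : Type*} (i : Fin n)
    (A : (Fin M₁ × Fin M₂) × (Fin n → Y₁ × Y₂) → α)
    (hA : ∀ w y y', (∀ j, j ≠ i → y j = y' j) → A (w, y) = A (w, y')) (a : α) (x : X)
    (b : Y₁ × Y₂) :
    law (c.blockLaw ch) (fun ω => (A ω, c.enc ω.1 i, (ω.2 i).1, (ω.2 i).2)) (a, x, b)
      = law (c.blockLaw ch) (fun ω => (A ω, c.enc ω.1 i)) (a, x) * ch.prob x b := by
  classical
  simp only [law, Fintype.sum_prod_type (α₁ := Fin M₁ × Fin M₂), Finset.sum_mul]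
  refine Finset.sum_congr rfl fun w _ => ?_
  by_cases hx : c.enc w i = x
  -- For fixed messages the outputs are independent, and the event A = a does not involve the output
  -- at time i, so that output factors out.
  · have h := sum_prod_mul_ite (fun j y => ch.prob (c.enc w j) y) i (ch.sum_eq_one _)
      (fun y => if A (w, y) = a then 1 / ((M₁ : ℝ) * M₂) else 0)
      (fun y y' hy => by rw [hA w y y' hy]) b
    rw [hx] at h
    rw [← Finset.sum_mul]
    convert h using 1
    · refine Finset.sum_congr rfl fun y _ => ?_
      by_cases h1 : A (w, y) = a <;> by_cases h2 : y i = b <;> simp [h1, h2, hx, blockLaw, mul_comm]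
    · congr 1
      refine Finset.sum_congr rfl fun y _ => ?_
      by_cases h1 : A (w, y) = a <;> simp [h1, hx, blockLaw, mul_comm]
  · simp [hx]

theorem sum_sum_eq_sum_pair {n : ℕ} {Y₁ Y₂ : Type*} [Fintype Y₁] [Fintype Y₂]
    (F : (Fin n → Y₁) → (Fin n → Y₂) → ℝ) :
    ∑ y₁, ∑ y₂, F y₁ y₂ = ∑ y : Fin n → Y₁ × Y₂, F (fun i => (y i).1) (fun i => (y i).2) := by
  rw [← Fintype.sum_prod_type' (f := F)]
  exact ((Equiv.arrowProdEquivProdArrow (Fin n) (fun _ => Y₁) (fun _ => Y₂)).sum_comp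
    fun z => F z.1 z.2).symm

open Classical in
theorem errorProb_eq : ch.errorProb c = ∑ ω : (Fin M₁ × Fin M₂) × (Fin n → Y₁ × Y₂),
    if c.dec₁ (fun i => (ω.2 i).1) ≠ ω.1.1 ∨ c.dec₂ (fun i => (ω.2 i).2) ≠ ω.1.2
      then c.blockLaw ch ω else 0 := by
  rw [Fintype.sum_prod_type, Fintype.sum_prod_type, BroadcastChannel.errorProb, Finset.mul_sum]
  refine Finset.sum_congr rfl fun w₁ _ => ?_
  rw [Finset.mul_sum]
  refine Finset.sum_congr rfl fun w₂ _ => ?_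
  rw [sum_sum_eq_sum_pair, Finset.mul_sum]
  refine Finset.sum_congr rfl fun y _ => ?_
  simp only [blockLaw, Prod.mk.eta]
  split_ifs <;> simp

variable [Fintype X]

/-- The subtracted 1 and 2 are the one-bit terms of one and of two applications of Fano's
inequality. -/
theorem mem_sumRegion (h₁ : 0 < M₁) (h₂ : 0 < M₂) (hn : 0 < n) :
    ((Real.logb 2 M₂ * (1 - ch.errorProb c) - 1) / n,
      ((Real.logb 2 M₁ + Real.logb 2 M₂) * (1 - ch.errorProb c) - 2) / n)
      ∈ sumRegion ch.marginal₁ ch.marginal₂ := by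
  classical
  set r := c.blockLaw ch with hrdef
  have hr := c.blockLaw_mem_stdSimplex ch h₁ h₂
  rw [← hrdef] at hr
  let B : (Fin M₁ × Fin M₂) × (Fin n → Y₁ × Y₂) → Fin n → Y₁ := fun ω i => (ω.2 i).1
  let C : (Fin M₁ × Fin M₂) × (Fin n → Y₁ × Y₂) → Fin n → Y₂ := fun ω i => (ω.2 i).2
  let T : (Fin M₁ × Fin M₂) × (Fin n → Y₁ × Y₂) → Fin M₂ := fun ω => ω.1.2
  let V := fun i : Fin n => punctured T B C i
  -- V_i omits the outputs at time i, hence V_i → Xᵢ → (Y₁ᵢ, Y₂ᵢ) is a Markov chain.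
  have hV := fun i : Fin n => BroadcastChannel.law_forget_output
    (c.law_blockLaw_markov ch i (V i) fun w y y' h => by
      simp only [V, punctured_eq_iff, T, B, C, true_and]
      exact fun j => ⟨fun hj => by rw [h j (Fin.ne_of_lt hj)],
        fun hj => by rw [h j (Fin.ne_of_gt hj)]⟩)
  have hI := fun i : Fin n => BroadcastChannel.law_forget_output
    (c.law_blockLaw_markov ch i (initial (fun ω => ω.1) B i) fun w y y' h => by
      simp only [initial_eq_iff, B, true_and]
      exact fun j hj => by rw [h j (Fin.ne_of_lt hj)])
  have hnoise := sum_condEntropy_initial (fun ω => ω.1) B r (fun ω => c.enc ω.1)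
    (fun ω ω' h => by rw [h])
  have hnoise' : ∀ i : Fin n, entropy r (fun ω => (initial (fun ω => ω.1) B i ω,
      c.enc ω.1 i, B ω i)) - entropy r (fun ω => (initial (fun ω => ω.1) B i ω, c.enc ω.1 i))
      = ∑ x, law r (fun ω => c.enc ω.1 i) x * rowEntropy ch.marginal₁ x :=
    fun i => condEntropy_input r ch.sum_marginal₁ (hI i).1
  simp only [hnoise'] at hnoise
  have hcsiszar := sum_entropy_punctured_sub T B C r
  have hcond := sum_condEntropy_punctured_le T B C r hr
  have hout : ∀ i : Fin n, outEntropy ch.marginal₂ (law r fun ω => c.enc ω.1 i)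
      = entropy r (fun ω => C ω i) := fun i =>
    (entropy_output r (law_forget (hV i).2)).symm
  have hsub : entropy r C ≤ ∑ i, entropy r (fun ω => C ω i) := entropy_pi_le hr C
  have hT : entropy r T = Real.logb 2 M₂ := by
    have := entropy_of_uniform r T (fun w => by
      rw [Fintype.card_fin]; exact c.law_blockLaw_snd ch h₁ w) (by simpa using h₂)
    rwa [Fintype.card_fin] at this
  have hmsg : entropy r (fun ω => ω.1) = Real.logb 2 M₁ + Real.logb 2 M₂ := by
    rw [entropy_of_uniform r (fun ω => ω.1) (fun w => by
      simpa using c.law_blockLaw_messages ch w) (by simpa using ⟨h₁, h₂⟩),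
      Fintype.card_prod, Fintype.card_fin, Fintype.card_fin, Nat.cast_mul, Real.logb_mul]
    · exact_mod_cast h₁.ne'
    · exact_mod_cast h₂.ne'
  have hfano₂ := entropy_fano hr T C c.dec₂
  -- Receiver 1 is given W₂ as well; its decoder ignores it, so the error probability is unchanged.
  have hfano₁ := entropy_fano hr (fun ω => ω.1.1) (fun ω => (T ω, B ω)) (fun z => c.dec₁ z.2)
  have hcongr : entropy r (fun ω => (ω.1.1, T ω, B ω)) = entropy r (fun ω => (ω.1, B ω)) :=
    entropy_congr r fun ω ω' => by simp [T, Prod.ext_iff, and_assoc]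
  have he₂ : (∑ ω, if c.dec₂ (C ω) ≠ T ω then r ω else 0) ≤ ch.errorProb c := by
    rw [errorProb_eq]
    refine Finset.sum_le_sum fun ω _ => ?_
    have := hr.1 ω
    by_cases h : c.dec₂ (C ω) = T ω
    · simp only [h, ne_eq, not_true_eq_false, if_false]
      split_ifs
      exacts [this, le_rfl]
    · rw [if_pos h, if_pos (Or.inr h)]
  have he₁ : (∑ ω, if c.dec₁ (T ω, B ω).2 ≠ ω.1.1 then r ω else 0) ≤ ch.errorProb c := by
    rw [errorProb_eq]
    refine Finset.sum_le_sum fun ω _ => ?_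
    have := hr.1 ω
    by_cases h : c.dec₁ (T ω, B ω).2 = ω.1.1
    · simp only [h, ne_eq, not_true_eq_false, if_false]
      split_ifs
      exacts [this, le_rfl]
    · rw [if_pos h, if_pos (Or.inl h)]
  have hM₁ : 0 ≤ Real.logb 2 M₁ := Real.logb_nonneg (by norm_num) (by exact_mod_cast h₁)
  have hM₂ : 0 ≤ Real.logb 2 M₂ := Real.logb_nonneg (by norm_num) (by exact_mod_cast h₂)
  have hfano₁' := hfano₁.trans (add_le_add_right (mul_le_mul_of_nonneg_right he₁ hM₁) 1)
  have hfano₂' := hfano₂.trans (add_le_add_right (mul_le_mul_of_nonneg_right he₂ hM₂) 1)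
  rw [hcongr] at hfano₁'
  have hn' : (0 : ℝ) < n := by exact_mod_cast hn
  -- The time index is uniform, which accounts for the division by n.
  refine sum_mem_sumRegion ch.marginal₂_nonneg (w := fun _ : Fin n => 1 / (n : ℝ))
    ⟨fun _ => by positivity, by simp [hn'.ne']⟩
    (fun i => mem_infoHull ch.sum_marginal₁ ch.sum_marginal₂ hr (hV i).1 (hV i).2) ?_ ?_
  · rw [← Finset.mul_sum, one_div_mul_eq_div]
    refine div_le_div_of_nonneg_right ?_ hn'.le
    simp only [hout, Finset.sum_sub_distrib] at hcond ⊢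
    linarith
  · rw [← Finset.mul_sum, one_div_mul_eq_div]
    refine div_le_div_of_nonneg_right ?_ hn'.le
    simp only [hout, Finset.sum_sub_distrib, Finset.sum_add_distrib] at hcsiszar ⊢
    linarith

end BroadcastCode

namespace BroadcastChannel

/-- Divide the bound for one code by n, let the error tend to 0, and use that the region is closed.
-/
theorem Achievable.mem_sumRegion {X Y₁ Y₂ : Type*} [Fintype X] [Fintype Y₁] [Fintype Y₂]
    {ch : BroadcastChannel X Y₁ Y₂} {R : ℝ × ℝ} (h : ch.Achievable R) :
    (R.2, R.1 + R.2) ∈ sumRegion ch.marginal₁ ch.marginal₂ := by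
  obtain ⟨h1, h2, c, hc⟩ := h
  have hlog : ∀ (n : ℕ) (ρ : ℝ), n * ρ ≤ Real.logb 2 ⌈(2 : ℝ) ^ ((n : ℝ) * ρ)⌉₊ := fun n ρ => by
    rw [Real.le_logb_iff_rpow_le (by norm_num)
      (by exact_mod_cast Nat.ceil_pos.2 (by positivity))]
    exact Nat.le_ceil _
  have hinv : Tendsto (fun n : ℕ => 1 / (n : ℝ)) atTop (𝓝 0) := tendsto_one_div_atTop_nhds_zero_nat
  have hlim : Tendsto (fun n : ℕ => (R.2 * (1 - ch.errorProb (c n)) - 1 / n,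
      (R.1 + R.2) * (1 - ch.errorProb (c n)) - 2 * (1 / (n : ℝ)))) atTop (𝓝 (R.2, R.1 + R.2)) := by
    have e1 := ((hc.const_sub 1).const_mul R.2).sub hinv
    have e2 := ((hc.const_sub 1).const_mul (R.1 + R.2)).sub (hinv.const_mul 2)
    simp only [sub_zero, mul_one, mul_zero] at e1 e2
    exact e1.prodMk_nhds e2
  refine (isClosed_sumRegion ch.marginal₁ ch.marginal₂).mem_of_tendsto hlim ?_
  filter_upwards [eventually_gt_atTop 0, hc.eventually (gt_mem_nhds one_pos)] with n hn hlt
  have hn' : (0 : ℝ) < n := by exact_mod_cast hn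
  obtain ⟨k, hk, ha, hb⟩ := (c n).mem_sumRegion ch (Nat.ceil_pos.2 (by positivity))
    (Nat.ceil_pos.2 (by positivity)) hn
  have hpos : 0 ≤ 1 - ch.errorProb (c n) := by linarith
  -- The region is closed downwards, so log M_j may be replaced by the smaller nR_j; the factor 1 -
  -- error is nonnegative for the n considered.
  refine ⟨k, hk, le_trans ?_ ha, le_trans ?_ hb⟩
  · rw [le_div_iff₀ hn']
    have := mul_le_mul_of_nonneg_right (hlog n R.2) hpos
    have e : (R.2 * (1 - ch.errorProb (c n)) - 1 / n) * n
        = n * R.2 * (1 - ch.errorProb (c n)) - 1 := by field_simp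
    dsimp only
    linarith
  · rw [le_div_iff₀ hn']
    have := mul_le_mul_of_nonneg_right (add_le_add (hlog n R.1) (hlog n R.2)) hpos
    have e : ((R.1 + R.2) * (1 - ch.errorProb (c n)) - 2 * (1 / n)) * n
        = (n * R.1 + n * R.2) * (1 - ch.errorProb (c n)) - 2 := by field_simp
    dsimp only
    linarith

end BroadcastChannel

namespace FinProb

/-! ### Averages over i.i.d. codebooks, and likelihood ratio tests. -/

section IID

variable {ι α : Type*} [Fintype ι] [DecidableEq ι] [Fintype α]

theorem sum_prod_eq_one {Q : α → ℝ} (hQ : ∑ c, Q c = 1) : ∑ C : ι → α, ∏ i, Q (C i) = 1 := by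
  rw [← Fintype.prod_sum (f := fun _ c => Q c)]
  simp [hQ]

theorem sum_prod_mul_split (Q : α → ℝ) (a : ι) (F : α → ({j // j ≠ a} → α) → ℝ) :
    ∑ C : ι → α, (∏ i, Q (C i)) * F (C a) (fun j => C j)
      = ∑ c, Q c * ∑ C : {j // j ≠ a} → α, (∏ j, Q (C j)) * F c C := by
  rw [← (Equiv.funSplitAt a α).symm.sum_comp, Fintype.sum_prod_type]
  refine Finset.sum_congr rfl fun c _ => ?_
  rw [Finset.mul_sum]
  refine Finset.sum_congr rfl fun C _ => ?_
  have h1 : (Equiv.funSplitAt a α).symm (c, C) a = c := by simp [Equiv.funSplitAt]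
  have h2 : ∀ j : {j // j ≠ a}, (Equiv.funSplitAt a α).symm (c, C) j = C j := fun j => by
    simp [Equiv.funSplitAt, j.2]
  rw [Fintype.prod_eq_mul_prod_subtype_ne _ a]
  simp only [h1, h2]
  ring

theorem sum_prod_mul_apply {Q : α → ℝ} (hQ : ∑ c, Q c = 1) (a : ι) (f : α → ℝ) :
    ∑ C : ι → α, (∏ i, Q (C i)) * f (C a) = ∑ c, Q c * f c := by
  rw [sum_prod_mul_split Q a fun c _ => f c]
  simp only [← Finset.sum_mul, sum_prod_eq_one hQ, one_mul]

theorem sum_prod_mul_apply₂ {Q : α → ℝ} (hQ : ∑ c, Q c = 1) {a b : ι} (hab : b ≠ a)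
    (f : α → α → ℝ) :
    ∑ C : ι → α, (∏ i, Q (C i)) * f (C a) (C b) = ∑ c, Q c * ∑ c', Q c' * f c c' := by
  rw [sum_prod_mul_split Q a fun c C => f c (C ⟨b, hab⟩)]
  simp only [sum_prod_mul_apply hQ]

/-- The step from a random codebook to an actual one: some value is at most the mean. -/
theorem exists_le_of_sum_mul_le {w : α → ℝ} (hw : w ∈ stdSimplex ℝ α) {f : α → ℝ} {b : ℝ}
    (h : ∑ a, w a * f a ≤ b) : ∃ a, f a ≤ b := by
  by_contra! hlt
  have h1 : ∑ a, w a * f a - b = ∑ a, w a * (f a - b) := by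
    simp only [mul_sub, Finset.sum_sub_distrib, ← Finset.sum_mul, hw.2, one_mul]
  have h2 : ∀ a, 0 ≤ w a * (f a - b) := fun a => mul_nonneg (hw.1 a) (by linarith [hlt a])
  have h3 : ∑ a, w a * (f a - b) = 0 :=
    le_antisymm (by linarith) (Finset.sum_nonneg fun a _ => h2 a)
  have h4 : ∀ a, w a = 0 := fun a => by
    have := (Finset.sum_eq_zero_iff_of_nonneg fun a _ => h2 a).1 h3 a (Finset.mem_univ a)
    exact (mul_eq_zero.1 this).resolve_right (by linarith [hlt a])
  have h5 := hw.2
  simp [h4] at h5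

end IID

/-- The indicator of a proposition. -/
def ind (p : Prop) : ℝ := open Classical in if p then 1 else 0

theorem ind_nonneg (p : Prop) : 0 ≤ ind p := by unfold ind; split_ifs <;> norm_num

theorem ind_of_true {p : Prop} (h : p) : ind p = 1 := if_pos h

theorem ind_of_false {p : Prop} (h : ¬p) : ind p = 0 := if_neg h

theorem ind_mono {p q : Prop} (h : p → q) : ind p ≤ ind q := by
  by_cases hp : p
  · rw [ind_of_true hp, ind_of_true (h hp)]
  · rw [ind_of_false hp]; exact ind_nonneg q

theorem ind_or_le (p q : Prop) : ind (p ∨ q) ≤ ind p + ind q := by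
  by_cases hp : p
  · rw [ind_of_true hp, ind_of_true (Or.inl hp)]; linarith [ind_nonneg q]
  · by_cases hq : q
    · rw [ind_of_true hq, ind_of_true (Or.inr hq)]; linarith [ind_nonneg p]
    · rw [ind_of_false (by tauto)]; exact add_nonneg (ind_nonneg p) (ind_nonneg q)

theorem ind_exists_le {ι : Type*} (s : Finset ι) (p : ι → Prop) :
    ind (∃ i ∈ s, p i) ≤ ∑ i ∈ s, ind (p i) := by
  by_cases h : ∃ i ∈ s, p i
  · obtain ⟨i, hi, hp⟩ := h
    rw [ind_of_true ⟨i, hi, hp⟩, ← ind_of_true hp]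
    exact Finset.single_le_sum (f := fun i => ind (p i)) (fun i _ => ind_nonneg _) hi
  · rw [ind_of_false h]
    exact Finset.sum_nonneg fun i _ => ind_nonneg _

/-- A likelihood ratio test at level `T` accepts an independent observation with probability at
most `1 / T`. -/
theorem sum_false_alarm_le {A Z : Type*} [Fintype A] [Fintype Z] {w : A → ℝ}
    (hw : w ∈ stdSimplex ℝ A) {W : A → Z → ℝ} (hW : ∀ a, W a ∈ stdSimplex ℝ Z) (b : Z → ℝ)
    {T : ℝ} (hT : 0 < T) {G : A → Z → Prop} (h : ∀ a z, G a z → T * b z ≤ W a z) :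
    ∑ a, w a * ∑ z, b z * ind (G a z) ≤ 1 / T := by
  have key : ∀ a, ∑ z, b z * ind (G a z) ≤ 1 / T := fun a => by
    rw [← (hW a).2, Finset.sum_div]
    refine Finset.sum_le_sum fun z _ => ?_
    by_cases hG : G a z
    · rw [ind_of_true hG, mul_one, le_div_iff₀ hT, mul_comm]
      exact h a z hG
    · rw [ind_of_false hG, mul_zero]
      exact div_nonneg ((hW a).1 z) hT.le
  calc _ ≤ ∑ a, w a * (1 / T) :=
        Finset.sum_le_sum fun a _ => mul_le_mul_of_nonneg_left (key a) (hw.1 a)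
    _ = 1 / T := by rw [← Finset.sum_mul, hw.2, one_mul]

/-- The decoder outputs any accepted index. It errs only if the true index is rejected or a false
one accepted, which is the form the union bounds need. -/
theorem exists_decoder {I Z : Type*} [Nonempty I] (G : I → Z → Prop) :
    ∃ d : Z → I, ∀ i z, d z ≠ i → ¬G i z ∨ ∃ j, j ≠ i ∧ G j z := by
  classical
  refine ⟨fun z => if h : ∃ i, G i z then h.choose else Classical.arbitrary I, fun i z hd => ?_⟩
  by_cases h : ∃ i, G i z
  · simp only [dif_pos h] at hd
    exact Or.inr ⟨_, hd, h.choose_spec⟩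
  · exact Or.inl fun hG => h ⟨i, hG⟩

/-! ### Mean error of a random superposition codebook. -/

section Superposition

variable {U X Y I J : Type*} [Fintype U] [Fintype X] [Fintype Y] [Fintype I] [Fintype J]
  [DecidableEq I] [DecidableEq J]

/-- The distribution of a cloud centre and its independent satellites. -/
def cloudLaw (P : U → ℝ) (κ : U → X → ℝ) (c : U × (J → X)) : ℝ := P c.1 * ∏ j, κ c.1 (c.2 j)

variable {P : U → ℝ} {κ : U → X → ℝ} (hP : P ∈ stdSimplex ℝ U) (hκ : ∀ u, κ u ∈ stdSimplex ℝ X)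

include hP hκ

theorem cloudLaw_mem_stdSimplex :
    (cloudLaw P κ : U × (J → X) → ℝ) ∈ stdSimplex ℝ (U × (J → X)) := by
  refine ⟨fun c => mul_nonneg (hP.1 _) (Finset.prod_nonneg fun j _ => (hκ _).1 _), ?_⟩
  rw [Fintype.sum_prod_type]
  simp only [cloudLaw, ← Finset.mul_sum, sum_prod_eq_one (hκ _).2, mul_one, hP.2]

omit hP in
theorem sum_cloudLaw_mul (j : J) (f : U → X → ℝ) :
    ∑ c : U × (J → X), cloudLaw P κ c * f c.1 (c.2 j) = ∑ u, P u * ∑ x, κ u x * f u x := by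
  rw [Fintype.sum_prod_type]
  simp only [cloudLaw, mul_assoc, ← Finset.mul_sum]
  simp only [fun u => sum_prod_mul_apply (hκ u).2 j (f u)]

omit hP in
theorem sum_cloudLaw_mul₂ {j j' : J} (hj : j' ≠ j) (f : U → X → X → ℝ) :
    ∑ c : U × (J → X), cloudLaw P κ c * f c.1 (c.2 j) (c.2 j')
      = ∑ u, P u * ∑ x, κ u x * ∑ x', κ u x' * f u x x' := by
  rw [Fintype.sum_prod_type]
  simp only [cloudLaw, mul_assoc, ← Finset.mul_sum]
  simp only [fun u => sum_prod_mul_apply₂ (hκ u).2 hj (f u)]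

omit hP in
theorem sum_cloudLaw_mul_fst (f : U → ℝ) :
    ∑ c : U × (J → X), cloudLaw P κ c * f c.1 = ∑ u, P u * f u := by
  rw [Fintype.sum_prod_type]
  simp only [cloudLaw, mul_assoc, ← Finset.mul_sum, ← Finset.sum_mul, sum_prod_eq_one (hκ _).2,
    one_mul]

variable {W : X → Y → ℝ} (hW : ∀ x, W x ∈ stdSimplex ℝ Y)

/-- The conditional output distribution given the cloud centre. -/
def condOut (κ : U → X → ℝ) (W : X → Y → ℝ) (u : U) (y : Y) : ℝ := ∑ x, κ u x * W x y

/-- The output distribution. -/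
def outLaw (P : U → ℝ) (κ : U → X → ℝ) (W : X → Y → ℝ) (y : Y) : ℝ := ∑ u, P u * condOut κ W u y

include hW

omit [Fintype U] hP in
theorem condOut_mem_stdSimplex (u : U) : condOut κ W u ∈ stdSimplex ℝ Y := by
  refine ⟨fun y => Finset.sum_nonneg fun x _ => mul_nonneg ((hκ u).1 x) ((hW x).1 y), ?_⟩
  simp only [condOut]
  rw [Finset.sum_comm]
  simp only [← Finset.mul_sum, (hW _).2, mul_one, (hκ u).2]

omit hW hP hκ in
theorem sum_outLaw_mul (f : Y → ℝ) :
    ∑ u, P u * ∑ x, κ u x * ∑ y, W x y * f y = ∑ y, outLaw P κ W y * f y := by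
  simp only [outLaw, condOut, Finset.sum_mul, Finset.mul_sum]
  rw [Finset.sum_comm]
  conv_rhs => rw [Finset.sum_comm]
  rw [Finset.sum_comm]
  refine Finset.sum_congr rfl fun u _ => ?_
  rw [Finset.sum_comm]
  exact Finset.sum_congr rfl fun x _ => Finset.sum_congr rfl fun y _ => by ring

omit [Fintype U] hW hP hκ in
theorem sum_condOut_mul (u : U) (f : Y → ℝ) :
    ∑ x, κ u x * ∑ y, W x y * f y = ∑ y, condOut κ W u y * f y := by
  simp only [condOut, Finset.sum_mul, Finset.mul_sum]
  rw [Finset.sum_comm]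
  exact Finset.sum_congr rfl fun x _ => Finset.sum_congr rfl fun y _ => by ring

/-- The mean error probability of decoding the cloud centre. -/
theorem sum_cloud_error_le {T : ℝ} (hT : 0 < T) {G : U → Y → Prop}
    (hG : ∀ u y, G u y → T * outLaw P κ W y ≤ condOut κ W u y) (a : I) (j : J)
    {E : (I → U × (J → X)) → Y → Prop}
    (hE : ∀ C y, E C y → ¬G (C a).1 y ∨ ∃ a', a' ≠ a ∧ G (C a').1 y) :
    ∑ C : I → U × (J → X), (∏ i, cloudLaw P κ (C i)) * ∑ y, W ((C a).2 j) y * ind (E C y)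
      ≤ (∑ u, P u * ∑ x, κ u x * ∑ y, W x y * ind (¬G u y))
        + ((Fintype.card I - 1 : ℕ) : ℝ) * (1 / T) := by
  have hQ := cloudLaw_mem_stdSimplex (J := J) hP hκ
  have hpt : ∀ (C : I → U × (J → X)) y, ind (E C y)
      ≤ ind (¬G (C a).1 y) + ∑ a' ∈ Finset.univ.erase a, ind (G (C a').1 y) := fun C y =>
    calc ind (E C y) ≤ ind (¬G (C a).1 y ∨ ∃ a' ∈ Finset.univ.erase a, G (C a').1 y) :=
          ind_mono fun h => by simpa using hE C y h
      _ ≤ _ := (ind_or_le _ _).trans (add_le_add_right (ind_exists_le _ _) _)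
  calc _ ≤ ∑ C : I → U × (J → X), (∏ i, cloudLaw P κ (C i)) * ∑ y, W ((C a).2 j) y *
        (ind (¬G (C a).1 y) + ∑ a' ∈ Finset.univ.erase a, ind (G (C a').1 y)) := by
        refine Finset.sum_le_sum fun C _ => mul_le_mul_of_nonneg_left ?_
          (Finset.prod_nonneg fun i _ => hQ.1 _)
        exact Finset.sum_le_sum fun y _ => mul_le_mul_of_nonneg_left (hpt C y) ((hW _).1 y)
    _ = ∑ C : I → U × (J → X), (∏ i, cloudLaw P κ (C i)) * (∑ y, W ((C a).2 j) y *
          ind (¬G (C a).1 y)) + ∑ a' ∈ Finset.univ.erase a,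
        ∑ C : I → U × (J → X), (∏ i, cloudLaw P κ (C i)) * ∑ y, W ((C a).2 j) y *
          ind (G (C a').1 y) := by
        rw [Finset.sum_comm, ← Finset.sum_add_distrib]
        refine Finset.sum_congr rfl fun C _ => ?_
        rw [← Finset.mul_sum, ← mul_add, Finset.sum_comm, ← Finset.sum_add_distrib]
        simp only [mul_add, Finset.mul_sum]
    _ ≤ _ := by
        refine add_le_add (le_of_eq ?_) ?_
        · rw [sum_prod_mul_apply hQ.2 a fun c => ∑ y, W (c.2 j) y * ind (¬G c.1 y),
            sum_cloudLaw_mul hκ j fun u x => ∑ y, W x y * ind (¬G u y)]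
        · have : ((Fintype.card I - 1 : ℕ) : ℝ) * (1 / T)
              = ∑ _a' ∈ Finset.univ.erase a, 1 / T := by
            rw [Finset.sum_const, Finset.card_erase_of_mem (Finset.mem_univ a), nsmul_eq_mul,
              Finset.card_univ]
          rw [this]
          refine Finset.sum_le_sum fun a' ha' => ?_
          rw [sum_prod_mul_apply₂ hQ.2 (Finset.ne_of_mem_erase ha').symm
            fun c' c => ∑ y, W (c.2 j) y * ind (G c'.1 y)]
          -- A wrong cloud centre is independent of the output, which then has its unconditional
          -- law.
          have hout : ∀ c : U × (J → X), ∑ c' : U × (J → X), cloudLaw P κ c' *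
              ∑ y, W (c'.2 j) y * ind (G c.1 y) = ∑ y, outLaw P κ W y * ind (G c.1 y) := fun c =>
            (sum_cloudLaw_mul hκ j fun _ x => ∑ y, W x y * ind (G c.1 y)).trans (sum_outLaw_mul _)
          simp only [hout]
          rw [sum_cloudLaw_mul_fst hκ fun u => ∑ y, outLaw P κ W y * ind (G u y)]
          exact sum_false_alarm_le hP (condOut_mem_stdSimplex hκ hW) _ hT hG

/-- The mean error probability of decoding both the cloud centre and the satellite. -/
theorem sum_satellite_error_le {T T' : ℝ} (hT : 0 < T) (hT' : 0 < T') {G : U → X → Y → Prop}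
    (hG : ∀ u x y, G u x y → T * condOut κ W u y ≤ W x y)
    (hG' : ∀ u x y, G u x y → T' * outLaw P κ W y ≤ W x y) (a : I) (j : J)
    {E : (I → U × (J → X)) → Y → Prop}
    (hE : ∀ C y, E C y → ¬G (C a).1 ((C a).2 j) y ∨
      ∃ b : I × J, b ≠ (a, j) ∧ G (C b.1).1 ((C b.1).2 b.2) y) :
    ∑ C : I → U × (J → X), (∏ i, cloudLaw P κ (C i)) * ∑ y, W ((C a).2 j) y * ind (E C y)
      ≤ (∑ u, P u * ∑ x, κ u x * ∑ y, W x y * ind (¬G u x y))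
        + ((Fintype.card J - 1 : ℕ) : ℝ) * (1 / T)
        + ((Fintype.card I - 1 : ℕ) : ℝ) * (Fintype.card J * (1 / T')) := by
  have hQ := cloudLaw_mem_stdSimplex (J := J) hP hκ
  have hpt : ∀ (C : I → U × (J → X)) y, ind (E C y)
      ≤ ind (¬G (C a).1 ((C a).2 j) y)
        + ∑ j' ∈ Finset.univ.erase j, ind (G (C a).1 ((C a).2 j') y)
        + ∑ a' ∈ Finset.univ.erase a, ∑ j', ind (G (C a').1 ((C a').2 j') y) := fun C y =>
    calc ind (E C y) ≤ ind ((¬G (C a).1 ((C a).2 j) y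
          ∨ ∃ j' ∈ Finset.univ.erase j, G (C a).1 ((C a).2 j') y)
          ∨ ∃ a' ∈ Finset.univ.erase a, ∃ j' ∈ Finset.univ, G (C a').1 ((C a').2 j') y) :=
          ind_mono fun h => by
            rcases hE C y h with h | ⟨⟨a', j'⟩, hb, h⟩
            · exact Or.inl (Or.inl h)
            · by_cases ha : a' = a
              · subst ha
                exact Or.inl (Or.inr ⟨j', by
                  simpa using fun hj => hb (by rw [hj]), h⟩)
              · exact Or.inr ⟨a', by simpa using ha, j', Finset.mem_univ _, h⟩
      _ ≤ _ := (ind_or_le _ _).trans (add_le_add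
          ((ind_or_le _ _).trans (add_le_add_right (ind_exists_le _ _) _))
          ((ind_exists_le _ _).trans (Finset.sum_le_sum fun a' _ => ind_exists_le _ _)))
  calc _ ≤ ∑ C : I → U × (J → X), (∏ i, cloudLaw P κ (C i)) * ∑ y, W ((C a).2 j) y *
        (ind (¬G (C a).1 ((C a).2 j) y)
        + ∑ j' ∈ Finset.univ.erase j, ind (G (C a).1 ((C a).2 j') y)
        + ∑ a' ∈ Finset.univ.erase a, ∑ j', ind (G (C a').1 ((C a').2 j') y)) := by
        refine Finset.sum_le_sum fun C _ => mul_le_mul_of_nonneg_left ?_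
          (Finset.prod_nonneg fun i _ => hQ.1 _)
        exact Finset.sum_le_sum fun y _ => mul_le_mul_of_nonneg_left (hpt C y) ((hW _).1 y)
    _ = ∑ C : I → U × (J → X), (∏ i, cloudLaw P κ (C i)) * (∑ y, W ((C a).2 j) y *
          ind (¬G (C a).1 ((C a).2 j) y))
        + ∑ j' ∈ Finset.univ.erase j, ∑ C : I → U × (J → X), (∏ i, cloudLaw P κ (C i)) *
          (∑ y, W ((C a).2 j) y * ind (G (C a).1 ((C a).2 j') y))
        + ∑ a' ∈ Finset.univ.erase a, ∑ j', ∑ C : I → U × (J → X),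
          (∏ i, cloudLaw P κ (C i)) * ∑ y, W ((C a).2 j) y * ind (G (C a').1 ((C a').2 j') y) := by
        rw [Finset.sum_comm (s := Finset.univ.erase j)]
        simp_rw [Finset.sum_comm (s := (Finset.univ : Finset J))
          (t := (Finset.univ : Finset (I → U × (J → X))))]
        rw [Finset.sum_comm (s := Finset.univ.erase a), ← Finset.sum_add_distrib,
          ← Finset.sum_add_distrib]
        refine Finset.sum_congr rfl fun C _ => ?_
        simp only [← Finset.mul_sum]
        rw [← mul_add, ← mul_add]
        congr 1
        simp only [mul_add, Finset.mul_sum, Finset.sum_add_distrib]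
        congr 1
        · rw [Finset.sum_comm (s := Finset.univ.erase j)]
        · rw [Finset.sum_comm]
          exact Finset.sum_congr rfl fun a' _ => Finset.sum_comm
    _ ≤ _ := by
        refine add_le_add (add_le_add (le_of_eq ?_) ?_) ?_
        · rw [sum_prod_mul_apply hQ.2 a fun c => ∑ y, W (c.2 j) y * ind (¬G c.1 (c.2 j) y),
            sum_cloudLaw_mul hκ j fun u x => ∑ y, W x y * ind (¬G u x y)]
        -- Right cloud, wrong satellite: given the cloud centre, the wrong satellite is independent
        -- of the output, which has law `condOut`.
        · have : ((Fintype.card J - 1 : ℕ) : ℝ) * (1 / T)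
              = ∑ _j' ∈ Finset.univ.erase j, 1 / T := by
            rw [Finset.sum_const, Finset.card_erase_of_mem (Finset.mem_univ j), nsmul_eq_mul,
              Finset.card_univ]
          rw [this]
          refine Finset.sum_le_sum fun j' hj' => ?_
          rw [sum_prod_mul_apply hQ.2 a fun c => ∑ y, W (c.2 j) y * ind (G c.1 (c.2 j') y),
            sum_cloudLaw_mul₂ hκ (Finset.ne_of_mem_erase hj').symm
              fun u x' x => ∑ y, W x y * ind (G u x' y)]
          simp only [sum_condOut_mul]
          calc _ ≤ ∑ u, P u * (1 / T) := Finset.sum_le_sum fun u _ =>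
                mul_le_mul_of_nonneg_left (sum_false_alarm_le (hκ u) hW _ hT (hG u)) (hP.1 u)
            _ = 1 / T := by rw [← Finset.sum_mul, hP.2, one_mul]
        -- Wrong cloud: the whole pair is independent of the output, which has law `outLaw`,
        -- whatever the satellite index.
        · have : ((Fintype.card I - 1 : ℕ) : ℝ) * (Fintype.card J * (1 / T'))
              = ∑ _a' ∈ Finset.univ.erase a, ∑ _j' : J, 1 / T' := by
            simp only [Finset.sum_const, Finset.card_erase_of_mem (Finset.mem_univ a),
              nsmul_eq_mul, Finset.card_univ]
          rw [this]
          refine Finset.sum_le_sum fun a' ha' => Finset.sum_le_sum fun j' _ => ?_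
          rw [sum_prod_mul_apply₂ hQ.2 (Finset.ne_of_mem_erase ha').symm
            fun c' c => ∑ y, W (c.2 j) y * ind (G c'.1 (c'.2 j') y)]
          have hout : ∀ c : U × (J → X), ∑ c' : U × (J → X), cloudLaw P κ c' *
              ∑ y, W (c'.2 j) y * ind (G c.1 (c.2 j') y)
              = ∑ y, outLaw P κ W y * ind (G c.1 (c.2 j') y) := fun c =>
            (sum_cloudLaw_mul hκ j fun _ x => ∑ y, W x y * ind (G c.1 (c.2 j') y)).trans
              (sum_outLaw_mul _)
          simp only [hout]
          rw [sum_cloudLaw_mul hκ j' fun u x => ∑ y, outLaw P κ W y * ind (G u x y)]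
          calc _ ≤ ∑ u, P u * (1 / T') := Finset.sum_le_sum fun u _ =>
                mul_le_mul_of_nonneg_left (sum_false_alarm_le (hκ u) hW _ hT' (hG' u)) (hP.1 u)
            _ = 1 / T' := by rw [← Finset.sum_mul, hP.2, one_mul]

end Superposition

/-! ### The weak law of large numbers and missed detection. -/

section LargeNumbers

variable {α : Type*} [Fintype α]

/-- Cross terms vanish by independence and zero mean. -/
theorem sum_prod_mul_sq {n : ℕ} {q g : α → ℝ} (hq : ∑ a, q a = 1) (hg : ∑ a, q a * g a = 0) :
    ∑ C : Fin n → α, (∏ i, q (C i)) * (∑ i, g (C i)) ^ 2 = n * ∑ a, q a * g a ^ 2 := by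
  have h : ∀ i j : Fin n, ∑ C : Fin n → α, (∏ i, q (C i)) * (g (C i) * g (C j))
      = if i = j then ∑ a, q a * g a ^ 2 else 0 := by
    intro i j
    split_ifs with hij
    · subst hij
      rw [sum_prod_mul_apply hq i fun a => g a * g a]
      simp only [sq]
    · rw [sum_prod_mul_apply₂ hq (Ne.symm hij) fun a b => g a * g b]
      have : ∀ a, ∑ b, q b * (g a * g b) = g a * ∑ b, q b * g b := fun a => by
        rw [Finset.mul_sum]; exact Finset.sum_congr rfl fun b _ => by ring
      simp [this, hg]
  calc _ = ∑ C : Fin n → α, ∑ i, ∑ j, (∏ i, q (C i)) * (g (C i) * g (C j)) :=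
        Finset.sum_congr rfl fun C _ => by rw [sq, Finset.sum_mul_sum]; simp only [Finset.mul_sum]
    _ = ∑ i, ∑ j, ∑ C : Fin n → α, (∏ i, q (C i)) * (g (C i) * g (C j)) := by
        rw [Finset.sum_comm]
        exact Finset.sum_congr rfl fun i _ => Finset.sum_comm
    _ = _ := by
        simp only [h, Finset.sum_ite_eq, Finset.mem_univ, if_true, Finset.sum_const,
          Finset.card_univ, Fintype.card_fin, nsmul_eq_mul]

/-- The weak law of large numbers, lower tail. -/
theorem tendsto_lower_tail {q : α → ℝ} (hq : q ∈ stdSimplex ℝ α) (f : α → ℝ) {γ : ℝ}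
    (hγ : γ < ∑ a, q a * f a) :
    Tendsto (fun n : ℕ => ∑ C : Fin n → α, (∏ i, q (C i)) * ind (∑ i, f (C i) < n * γ))
      atTop (𝓝 0) := by
  set m := ∑ a, q a * f a with hm
  have hδ : 0 < m - γ := by linarith
  set v := ∑ a, q a * (f a - m) ^ 2
  have hg : ∑ a, q a * (f a - m) = 0 := by
    simp only [mul_sub, Finset.sum_sub_distrib, ← Finset.sum_mul, hq.2, ← hm]; ring
  have hbound : ∀ᶠ n : ℕ in atTop,
      ∑ C : Fin n → α, (∏ i, q (C i)) * ind (∑ i, f (C i) < n * γ)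
        ≤ v / (m - γ) ^ 2 * (1 / (n : ℝ)) := by
    filter_upwards [eventually_gt_atTop 0] with n hn
    have hn' : (0 : ℝ) < n := by exact_mod_cast hn
    -- Chebyshev's inequality, pointwise.
    have hpt : ∀ C : Fin n → α, ind (∑ i, f (C i) < n * γ)
        ≤ (∑ i, (f (C i) - m)) ^ 2 / (n * (m - γ)) ^ 2 := fun C => by
      by_cases h : ∑ i, f (C i) < n * γ
      · rw [ind_of_true h, one_le_div (by positivity)]
        simp only [Finset.sum_sub_distrib, Finset.sum_const, Finset.card_univ, Fintype.card_fin,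
          nsmul_eq_mul]
        rw [← neg_sq (_ - _)]
        refine pow_le_pow_left₀ (by positivity) ?_ 2
        linarith
      · rw [ind_of_false h]; positivity
    calc _ ≤ ∑ C : Fin n → α, (∏ i, q (C i)) * ((∑ i, (f (C i) - m)) ^ 2 / (n * (m - γ)) ^ 2) :=
          Finset.sum_le_sum fun C _ => mul_le_mul_of_nonneg_left (hpt C)
            (Finset.prod_nonneg fun i _ => hq.1 _)
      _ = v / (m - γ) ^ 2 * (1 / (n : ℝ)) := by
          simp only [← mul_div_assoc]
          rw [← Finset.sum_div, sum_prod_mul_sq hq.2 hg]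
          field_simp
          rfl
  refine squeeze_zero' (Eventually.of_forall fun n => Finset.sum_nonneg fun C _ =>
    mul_nonneg (Finset.prod_nonneg fun i _ => hq.1 _) (ind_nonneg _)) hbound ?_
  simpa using tendsto_one_div_atTop_nhds_zero_nat.const_mul (v / (m - γ) ^ 2)

/-- The probability of missed detection of a likelihood ratio test. -/
theorem tendsto_missed_detection {q : α → ℝ} (hq : q ∈ stdSimplex ℝ α) {N D : α → ℝ}
    (hN : ∀ a, 0 < q a → 0 < N a) (hD : ∀ a, 0 < q a → 0 < D a) {γ : ℝ}
    (hγ : γ < ∑ a, q a * (Real.logb 2 (N a) - Real.logb 2 (D a))) :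
    Tendsto (fun n : ℕ => ∑ C : Fin n → α, (∏ i, q (C i)) *
      ind (¬((2 : ℝ) ^ ((n : ℝ) * γ) * ∏ i, D (C i) ≤ ∏ i, N (C i)))) atTop (𝓝 0) := by
  refine squeeze_zero (fun n => Finset.sum_nonneg fun C _ =>
    mul_nonneg (Finset.prod_nonneg fun i _ => hq.1 _) (ind_nonneg _)) (fun n => ?_)
    (tendsto_lower_tail hq _ hγ)
  refine Finset.sum_le_sum fun C _ => ?_
  -- Sequences with a letter of probability 0 have no weight; on the others all likelihoods are
  -- positive and logarithms may be taken.
  by_cases h : ∃ i, q (C i) = 0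
  · obtain ⟨i, hi⟩ := h
    rw [Finset.prod_eq_zero (Finset.mem_univ i) hi, zero_mul, zero_mul]
  · push Not at h
    have hpos : ∀ i, 0 < q (C i) := fun i => (hq.1 _).lt_of_ne' (h i)
    refine mul_le_mul_of_nonneg_left (ind_mono fun hlt => ?_)
      (Finset.prod_nonneg fun i _ => hq.1 _)
    rw [not_le] at hlt
    have hNp : 0 < ∏ i, N (C i) := Finset.prod_pos fun i _ => hN _ (hpos i)
    have hDp : 0 < ∏ i, D (C i) := Finset.prod_pos fun i _ => hD _ (hpos i)
    have h1 := Real.logb_lt_logb (b := 2) (by norm_num) hNp hlt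
    rw [Real.logb_mul (by positivity) hDp.ne', Real.logb_rpow (by norm_num) (by norm_num),
      Real.logb_prod _ _ fun i _ => (hN _ (hpos i)).ne',
      Real.logb_prod _ _ fun i _ => (hD _ (hpos i)).ne'] at h1
    rw [Finset.sum_sub_distrib]
    linarith

end LargeNumbers

/-! ### Product laws for n uses, and mean log-likelihoods. -/

section Block

variable {U X Y : Type*} [Fintype U] [Fintype X] [Fintype Y]

theorem prod_mem_stdSimplex {ι : Type*} [Fintype ι] [DecidableEq ι] {Q : ι → X → ℝ}
    (hQ : ∀ i, Q i ∈ stdSimplex ℝ X) :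
    (fun x : ι → X => ∏ i, Q i (x i)) ∈ stdSimplex ℝ (ι → X) := by
  refine ⟨fun x => Finset.prod_nonneg fun i _ => (hQ i).1 _, ?_⟩
  rw [← Fintype.prod_sum]
  simp [(hQ _).2]

omit [Fintype U] [Fintype Y] in
theorem condOut_prod {n : ℕ} (κ : U → X → ℝ) (W : X → Y → ℝ) (u : Fin n → U) (y : Fin n → Y) :
    condOut (fun (u : Fin n → U) (x : Fin n → X) => ∏ i, κ (u i) (x i))
      (fun (x : Fin n → X) (y : Fin n → Y) => ∏ i, W (x i) (y i)) u y
      = ∏ i, condOut κ W (u i) (y i) := by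
  simp only [condOut, Fintype.prod_sum, Finset.prod_mul_distrib]

omit [Fintype Y] in
theorem outLaw_prod {n : ℕ} (P : U → ℝ) (κ : U → X → ℝ) (W : X → Y → ℝ) (y : Fin n → Y) :
    outLaw (fun u : Fin n → U => ∏ i, P (u i))
      (fun (u : Fin n → U) (x : Fin n → X) => ∏ i, κ (u i) (x i))
      (fun (x : Fin n → X) (y : Fin n → Y) => ∏ i, W (x i) (y i)) y
      = ∏ i, outLaw P κ W (y i) := by
  simp only [outLaw, condOut_prod, Fintype.prod_sum, Finset.prod_mul_distrib]

/-- The joint distribution of cloud centre, input and output. -/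
def chainLaw (P : U → ℝ) (κ : U → X → ℝ) (W : X → Y → ℝ) (θ : U × X × Y) : ℝ :=
  P θ.1 * (κ θ.1 θ.2.1 * W θ.2.1 θ.2.2)

theorem sum_chainLaw_mul (P : U → ℝ) (κ : U → X → ℝ) (W : X → Y → ℝ) (F : U → X → Y → ℝ) :
    ∑ θ, chainLaw P κ W θ * F θ.1 θ.2.1 θ.2.2
      = ∑ u, P u * ∑ x, κ u x * ∑ y, W x y * F u x y := by
  simp only [Fintype.sum_prod_type, chainLaw, Finset.mul_sum, mul_assoc]

/-- Regroups three n-tuples into n i.i.d. triples, to which the law of large numbers applies. -/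
theorem sum_block_mul {n : ℕ} (P : U → ℝ) (κ : U → X → ℝ) (W : X → Y → ℝ)
    (F : (Fin n → U) → (Fin n → X) → (Fin n → Y) → ℝ) :
    ∑ u : Fin n → U, (∏ i, P (u i)) * ∑ x : Fin n → X, (∏ i, κ (u i) (x i)) *
      ∑ y : Fin n → Y, (∏ i, W (x i) (y i)) * F u x y
      = ∑ θ : Fin n → U × X × Y, (∏ i, chainLaw P κ W (θ i)) *
        F (fun i => (θ i).1) (fun i => (θ i).2.1) (fun i => (θ i).2.2) := by
  have h : ∀ u : Fin n → U, ∑ x : Fin n → X, (∏ i, κ (u i) (x i)) *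
      ∑ y : Fin n → Y, (∏ i, W (x i) (y i)) * F u x y
      = ∑ z : Fin n → X × Y, (∏ i, κ (u i) (z i).1 * W (z i).1 (z i).2) *
        F u (fun i => (z i).1) (fun i => (z i).2) := fun u => by
    simp only [Finset.mul_sum]
    rw [BroadcastCode.sum_sum_eq_sum_pair]
    simp only [Finset.prod_mul_distrib, mul_assoc]
  simp only [h]
  simp only [Finset.mul_sum]
  rw [BroadcastCode.sum_sum_eq_sum_pair]
  simp only [Finset.prod_mul_distrib, mul_assoc, chainLaw]

variable {P : U → ℝ} {κ : U → X → ℝ} {W : X → Y → ℝ} (hP : P ∈ stdSimplex ℝ U)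
  (hκ : ∀ u, κ u ∈ stdSimplex ℝ X) (hW : ∀ x, W x ∈ stdSimplex ℝ Y)

include hP hκ hW

theorem chainLaw_mem_stdSimplex : chainLaw P κ W ∈ stdSimplex ℝ (U × X × Y) := by
  refine ⟨fun θ => mul_nonneg (hP.1 _) (mul_nonneg ((hκ _).1 _) ((hW _).1 _)), ?_⟩
  have h := sum_chainLaw_mul P κ W fun _ _ _ => 1
  simp only [mul_one, (hW _).2, (hκ _).2, hP.2] at h
  exact h

theorem pos_of_chainLaw_pos {θ : U × X × Y} (h : 0 < chainLaw P κ W θ) :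
    0 < W θ.2.1 θ.2.2 ∧ 0 < condOut κ W θ.1 θ.2.2 ∧ 0 < outLaw P κ W θ.2.2 := by
  have hc := condOut_mem_stdSimplex hκ hW
  have h1 : P θ.1 ≠ 0 := fun h0 => by simp [chainLaw, h0] at h
  have h2 : κ θ.1 θ.2.1 * W θ.2.1 θ.2.2 ≠ 0 := fun h0 => by simp [chainLaw, h0] at h
  have h3 : 0 < condOut κ W θ.1 θ.2.2 :=
    ((mul_nonneg ((hκ _).1 _) ((hW _).1 _)).lt_of_ne' h2).trans_le
      (Finset.single_le_sum (f := fun x => κ θ.1 x * W x θ.2.2)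
        (fun x _ => mul_nonneg ((hκ _).1 _) ((hW _).1 _)) (Finset.mem_univ θ.2.1))
  refine ⟨((hW _).1 _).lt_of_ne' (right_ne_zero_of_mul h2), h3, ?_⟩
  exact (mul_pos ((hP.1 _).lt_of_ne' h1) h3).trans_le
    (Finset.single_le_sum (f := fun u => P u * condOut κ W u θ.2.2)
      (fun u _ => mul_nonneg (hP.1 u) ((hc u).1 _)) (Finset.mem_univ θ.1))

omit hP hκ hW

/-- This and the next two lemmas identify mean log-likelihoods with -H(Y), -H(Y|U) and -H(Y|X).
Their differences I(U;Y), I(X;Y|U), I(X;Y) are the mean log-likelihood ratios of the three tests. -/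
theorem sum_chainLaw_logb_output (P : U → ℝ) (κ : U → X → ℝ) (W : X → Y → ℝ) :
    ∑ θ, chainLaw P κ W θ * Real.logb 2 (outLaw P κ W θ.2.2)
      = -outEntropy W (fun x => ∑ u, P u * κ u x) := by
  have h := sum_chainLaw_mul P κ W fun _ _ y => Real.logb 2 (outLaw P κ W y)
  rw [sum_outLaw_mul] at h
  rw [h, outEntropy, ← Finset.sum_neg_distrib]
  refine Finset.sum_congr rfl fun y _ => ?_
  have : ∑ x, (∑ u, P u * κ u x) * W x y = outLaw P κ W y := by
    simp only [outLaw, condOut, Finset.sum_mul, Finset.mul_sum]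
    rw [Finset.sum_comm]
    exact Finset.sum_congr rfl fun u _ => Finset.sum_congr rfl fun x _ => by ring
  rw [this, Real.negMulLog, Real.logb]
  ring

theorem sum_chainLaw_logb_cond (P : U → ℝ) (κ : U → X → ℝ) (W : X → Y → ℝ) :
    ∑ θ, chainLaw P κ W θ * Real.logb 2 (condOut κ W θ.1 θ.2.2)
      = -∑ u, P u * outEntropy W (κ u) := by
  have h := sum_chainLaw_mul P κ W fun u _ y => Real.logb 2 (condOut κ W u y)
  simp only [sum_condOut_mul] at h
  rw [h, ← Finset.sum_neg_distrib]
  refine Finset.sum_congr rfl fun u _ => ?_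
  rw [outEntropy, Finset.mul_sum, Finset.mul_sum, ← Finset.sum_neg_distrib]
  refine Finset.sum_congr rfl fun y _ => ?_
  change _ = -(P u * (Real.negMulLog (condOut κ W u y) / _))
  rw [Real.negMulLog, Real.logb]
  ring

theorem sum_chainLaw_logb_row (P : U → ℝ) (κ : U → X → ℝ) (W : X → Y → ℝ) :
    ∑ θ, chainLaw P κ W θ * Real.logb 2 (W θ.2.1 θ.2.2)
      = -∑ x, (∑ u, P u * κ u x) * rowEntropy W x := by
  rw [sum_chainLaw_mul P κ W fun _ x y => Real.logb 2 (W x y)]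
  simp only [Finset.mul_sum, Finset.sum_mul]
  conv_rhs => rw [Finset.sum_comm]
  rw [← Finset.sum_neg_distrib]
  refine Finset.sum_congr rfl fun u _ => ?_
  rw [← Finset.sum_neg_distrib]
  refine Finset.sum_congr rfl fun x _ => ?_
  rw [rowEntropy, Finset.mul_sum, ← Finset.sum_neg_distrib]
  refine Finset.sum_congr rfl fun y _ => ?_
  rw [Real.negMulLog, Real.logb]
  ring

end Block

end FinProb

/-! ### One-shot superposition coding. -/

namespace BroadcastChannel

variable {X Y₁ Y₂ : Type*} [Fintype X] [Fintype Y₁] [Fintype Y₂]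

omit [Fintype X] in
theorem marginal₁_mem_stdSimplex (ch : BroadcastChannel X Y₁ Y₂) (x : X) :
    ch.marginal₁ x ∈ stdSimplex ℝ Y₁ := ⟨ch.marginal₁_nonneg x, ch.sum_marginal₁ x⟩

omit [Fintype X] in
theorem marginal₂_mem_stdSimplex (ch : BroadcastChannel X Y₁ Y₂) (x : X) :
    ch.marginal₂ x ∈ stdSimplex ℝ Y₂ := ⟨ch.marginal₂_nonneg x, ch.sum_marginal₂ x⟩

/-- The memoryless extension of a channel to `n` uses. -/
def power (ch : BroadcastChannel X Y₁ Y₂) (n : ℕ) :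
    BroadcastChannel (Fin n → X) (Fin n → Y₁) (Fin n → Y₂) where
  prob x y := ∏ i, ch.prob (x i) (y.1 i, y.2 i)
  nonneg x y := Finset.prod_nonneg fun i _ => ch.nonneg _ _
  sum_eq_one x := by
    rw [Fintype.sum_prod_type, BroadcastCode.sum_sum_eq_sum_pair]
    exact BroadcastCode.sum_prod_prob ch x

omit [Fintype X] in
theorem marginal₁_power (ch : BroadcastChannel X Y₁ Y₂) (n : ℕ) :
    (ch.power n).marginal₁ = fun x y => ∏ i, ch.marginal₁ (x i) (y i) := by
  ext x y
  simp only [marginal₁, power, Fintype.prod_sum]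

omit [Fintype X] in
theorem marginal₂_power (ch : BroadcastChannel X Y₁ Y₂) (n : ℕ) :
    (ch.power n).marginal₂ = fun x y => ∏ i, ch.marginal₂ (x i) (y i) := by
  ext x y
  simp only [marginal₂, power, Fintype.prod_sum]

omit [Fintype X] in
-- Union bound over the receivers: from here on only the two marginal channels matter.
theorem sum_prob_mul_ind_or_le (ch : BroadcastChannel X Y₁ Y₂) (x : X) (p : Y₁ → Prop)
    (q : Y₂ → Prop) : ∑ y₁, ∑ y₂, ch.prob x (y₁, y₂) * ind (p y₁ ∨ q y₂)
      ≤ ∑ y₁, ch.marginal₁ x y₁ * ind (p y₁) + ∑ y₂, ch.marginal₂ x y₂ * ind (q y₂) := by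
  simp only [marginal₁, marginal₂, Finset.sum_mul]
  rw [Finset.sum_comm (f := fun y₂ y₁ => ch.prob x (y₁, y₂) * ind (q y₂)),
    ← Finset.sum_add_distrib]
  refine Finset.sum_le_sum fun y₁ _ => ?_
  rw [← Finset.sum_add_distrib]
  refine Finset.sum_le_sum fun y₂ _ => ?_
  rw [← mul_add]
  exact mul_le_mul_of_nonneg_left (ind_or_le _ _) (ch.nonneg _ _)

/-- Superposition coding for a single use of a broadcast channel. -/
theorem exists_superposition_code (ch : BroadcastChannel X Y₁ Y₂) {U : Type*} [Fintype U]
    {P : U → ℝ} {κ : U → X → ℝ} (hP : P ∈ stdSimplex ℝ U) (hκ : ∀ u, κ u ∈ stdSimplex ℝ X)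
    {M₁ M₂ K L : ℕ} (h₁ : 0 < M₁) (h₂ : 0 < M₂) (hKL : M₁ ≤ K * L) {T₀ T₁ T₂ : ℝ}
    (hT₀ : 0 < T₀) (hT₁ : 0 < T₁) (hT₂ : 0 < T₂) {G₁ : U → X → Y₁ → Prop} {G₂ : U → Y₂ → Prop}
    (hG₀ : ∀ u x y, G₁ u x y → T₀ * outLaw P κ ch.marginal₁ y ≤ ch.marginal₁ x y)
    (hG₁ : ∀ u x y, G₁ u x y → T₁ * condOut κ ch.marginal₁ u y ≤ ch.marginal₁ x y)
    (hG₂ : ∀ u y, G₂ u y → T₂ * outLaw P κ ch.marginal₂ y ≤ condOut κ ch.marginal₂ u y) :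
    ∃ (enc : Fin M₁ × Fin M₂ → X) (d₁ : Y₁ → Fin M₁) (d₂ : Y₂ → Fin M₂),
      1 / ((M₁ : ℝ) * M₂) * ∑ w₁, ∑ w₂, ∑ y₁, ∑ y₂,
        ch.prob (enc (w₁, w₂)) (y₁, y₂) * ind (d₁ y₁ ≠ w₁ ∨ d₂ y₂ ≠ w₂)
      ≤ ((∑ u, P u * ∑ x, κ u x * ∑ y, ch.marginal₁ x y * ind (¬G₁ u x y))
          + ((L - 1 : ℕ) : ℝ) * (1 / T₁) + ((M₂ * K - 1 : ℕ) : ℝ) * (L * (1 / T₀)))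
        + ((∑ u, P u * ∑ x, κ u x * ∑ y, ch.marginal₂ x y * ind (¬G₂ u y))
          + ((M₂ * K - 1 : ℕ) : ℝ) * (1 / T₂)) := by
  have : NeZero M₁ := ⟨h₁.ne'⟩
  have : NeZero M₂ := ⟨h₂.ne'⟩
  have : NeZero K := ⟨by rintro rfl; omega⟩
  have : NeZero L := ⟨by rintro rfl; omega⟩
  -- The first message is split into a cloud part in K and a satellite part in L. An embedding
  -- suffices, so M₁ need not equal K * L; clouds are indexed by the second message and the part in
  -- K.
  obtain ⟨ι⟩ : Nonempty (Fin M₁ ↪ Fin K × Fin L) :=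
    Function.Embedding.nonempty_of_card_le (by simpa using hKL)
  let I := Fin M₂ × Fin K
  choose D₁ hD₁ using fun C : I → U × (Fin L → X) =>
    exists_decoder (I := I × Fin L) (Z := Y₁) fun b y => G₁ (C b.1).1 ((C b.1).2 b.2) y
  choose D₂ hD₂ using fun C : I → U × (Fin L → X) =>
    exists_decoder (I := I) (Z := Y₂) fun a y => G₂ (C a).1 y
  let enc : (I → U × (Fin L → X)) → Fin M₁ × Fin M₂ → X :=
    fun C w => (C (w.2, (ι w.1).1)).2 (ι w.1).2
  let d₁ : (I → U × (Fin L → X)) → Y₁ → Fin M₁ :=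
    fun C y => Function.invFun ι ((D₁ C y).1.2, (D₁ C y).2)
  let d₂ : (I → U × (Fin L → X)) → Y₂ → Fin M₂ := fun C y => (D₂ C y).1
  have hd₁ : ∀ C w₁ (w₂ : Fin M₂) y, d₁ C y ≠ w₁ →
      ¬G₁ (C (w₂, (ι w₁).1)).1 ((C (w₂, (ι w₁).1)).2 (ι w₁).2) y ∨ ∃ b : I × Fin L,
        b ≠ ((w₂, (ι w₁).1), (ι w₁).2) ∧ G₁ (C b.1).1 ((C b.1).2 b.2) y := by
    intro C w₁ w₂ y h
    refine hD₁ C ((w₂, (ι w₁).1), (ι w₁).2) y fun heq => h ?_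
    simp only [d₁, heq]
    exact Function.leftInverse_invFun ι.injective w₁
  have hd₂ : ∀ C (w₁ : Fin M₁) w₂ y, d₂ C y ≠ w₂ → ¬G₂ (C (w₂, (ι w₁).1)).1 y ∨
      ∃ a, a ≠ (w₂, (ι w₁).1) ∧ G₂ (C a).1 y := fun C w₁ w₂ y h =>
    hD₂ C (w₂, (ι w₁).1) y fun heq => h (by simp only [d₂, heq])
  have hQ := prod_mem_stdSimplex (ι := I)
    fun _ => cloudLaw_mem_stdSimplex (J := Fin L) hP hκ
  set B := ((∑ u, P u * ∑ x, κ u x * ∑ y, ch.marginal₁ x y * ind (¬G₁ u x y))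
          + ((L - 1 : ℕ) : ℝ) * (1 / T₁) + ((M₂ * K - 1 : ℕ) : ℝ) * (L * (1 / T₀)))
        + ((∑ u, P u * ∑ x, κ u x * ∑ y, ch.marginal₂ x y * ind (¬G₂ u y))
          + ((M₂ * K - 1 : ℕ) : ℝ) * (1 / T₂)) with hB
  have key : ∀ w₁ w₂, ∑ C : I → U × (Fin L → X), (∏ i, cloudLaw P κ (C i)) *
      ∑ y₁, ∑ y₂, ch.prob (enc C (w₁, w₂)) (y₁, y₂) * ind (d₁ C y₁ ≠ w₁ ∨ d₂ C y₂ ≠ w₂) ≤ B := by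
    intro w₁ w₂
    have e₁ := sum_satellite_error_le hP hκ ch.marginal₁_mem_stdSimplex hT₁ hT₀ hG₁ hG₀
      (w₂, (ι w₁).1) (ι w₁).2 (E := fun C y => d₁ C y ≠ w₁) fun C y => hd₁ C w₁ w₂ y
    have e₂ := sum_cloud_error_le hP hκ ch.marginal₂_mem_stdSimplex hT₂ hG₂
      (w₂, (ι w₁).1) (ι w₁).2 (E := fun C y => d₂ C y ≠ w₂) fun C y => hd₂ C w₁ w₂ y
    simp only [Fintype.card_prod, Fintype.card_fin] at e₁ e₂
    refine le_trans ?_ (add_le_add e₁ e₂)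
    rw [← Finset.sum_add_distrib]
    refine Finset.sum_le_sum fun C _ => ?_
    rw [← mul_add]
    exact mul_le_mul_of_nonneg_left (ch.sum_prob_mul_ind_or_le _ _ _) (hQ.1 C)
  have hM : 0 < (M₁ : ℝ) * M₂ := by positivity
  -- The bound holds on average over codebooks for each message pair, hence for the average over
  -- pairs, hence for some codebook.
  suffices hsum : ∑ C : I → U × (Fin L → X), (∏ i, cloudLaw P κ (C i)) *
      (1 / ((M₁ : ℝ) * M₂) * ∑ w₁, ∑ w₂, ∑ y₁, ∑ y₂, ch.prob (enc C (w₁, w₂)) (y₁, y₂) *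
        ind (d₁ C y₁ ≠ w₁ ∨ d₂ C y₂ ≠ w₂)) ≤ B by
    obtain ⟨C, hC⟩ := exists_le_of_sum_mul_le hQ hsum
    exact ⟨enc C, d₁ C, d₂ C, hC⟩
  calc _ = 1 / ((M₁ : ℝ) * M₂) * ∑ w₁, ∑ w₂, ∑ C : I → U × (Fin L → X),
        (∏ i, cloudLaw P κ (C i)) * ∑ y₁, ∑ y₂, ch.prob (enc C (w₁, w₂)) (y₁, y₂) *
          ind (d₁ C y₁ ≠ w₁ ∨ d₂ C y₂ ≠ w₂) := by
        simp only [mul_left_comm _ (1 / ((M₁ : ℝ) * M₂)), ← Finset.mul_sum]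
        congr 1
        simp only [fun C : I → U × (Fin L → X) => Finset.mul_sum Finset.univ (fun w₁ => ∑ w₂,
          ∑ y₁, ∑ y₂, ch.prob (enc C (w₁, w₂)) (y₁, y₂) *
            ind (d₁ C y₁ ≠ w₁ ∨ d₂ C y₂ ≠ w₂)) (∏ i, cloudLaw P κ (C i))]
        rw [Finset.sum_comm]
        refine Finset.sum_congr rfl fun w₁ _ => ?_
        rw [Finset.sum_comm]
        exact Finset.sum_congr rfl fun C _ => Finset.mul_sum _ _ _
    _ ≤ 1 / ((M₁ : ℝ) * M₂) * ∑ _w₁ : Fin M₁, ∑ _w₂ : Fin M₂, B :=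
        mul_le_mul_of_nonneg_left (Finset.sum_le_sum fun w₁ _ => Finset.sum_le_sum fun w₂ _ =>
          key w₁ w₂) (by positivity)
    _ = B := by
        simp only [Finset.sum_const, Finset.card_univ, Fintype.card_fin, nsmul_eq_mul]
        field_simp

end BroadcastChannel

theorem ceil_two_rpow_le {ρ : ℝ} (hρ : 0 ≤ ρ) (n : ℕ) :
    (⌈(2 : ℝ) ^ ((n : ℝ) * ρ)⌉₊ : ℝ) ≤ 2 * (2 : ℝ) ^ ((n : ℝ) * ρ) := by
  have h1 : (1 : ℝ) ≤ (2 : ℝ) ^ ((n : ℝ) * ρ) :=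
    Real.one_le_rpow (by norm_num) (by positivity)
  have h2 := (Nat.ceil_lt_add_one (by positivity : 0 ≤ (2 : ℝ) ^ ((n : ℝ) * ρ))).le
  linarith

theorem tendsto_mul_one_div_two_rpow {a : ℕ → ℕ} {c ρ γ : ℝ} (hργ : ρ < γ)
    (ha : ∀ n, (a n : ℝ) ≤ c * (2 : ℝ) ^ ((n : ℝ) * ρ)) :
    Tendsto (fun n : ℕ => (a n : ℝ) * (1 / (2 : ℝ) ^ ((n : ℝ) * γ))) atTop (𝓝 0) := by
  have hlim : Tendsto (fun n : ℕ => c * ((2 : ℝ) ^ (ρ - γ)) ^ n) atTop (𝓝 0) := by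
    have := tendsto_pow_atTop_nhds_zero_of_lt_one (r := (2 : ℝ) ^ (ρ - γ)) (by positivity)
      (Real.rpow_lt_one_of_one_lt_of_neg (by norm_num) (by linarith))
    simpa using this.const_mul c
  refine squeeze_zero (fun n => by positivity) (fun n => ?_) hlim
  calc (a n : ℝ) * (1 / (2 : ℝ) ^ ((n : ℝ) * γ))
      ≤ c * (2 : ℝ) ^ ((n : ℝ) * ρ) * (1 / (2 : ℝ) ^ ((n : ℝ) * γ)) :=
        mul_le_mul_of_nonneg_right (ha n) (by positivity)
    _ = c * ((2 : ℝ) ^ (ρ - γ)) ^ n := by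
        rw [← Real.rpow_natCast, ← Real.rpow_mul (by norm_num), mul_assoc, mul_one_div,
          ← Real.rpow_sub (by norm_num)]
        ring_nf

/-! ### Achievable rates and the capacity region. -/

namespace BroadcastChannel

variable {X Y₁ Y₂ : Type*} [Fintype X] [Fintype Y₁] [Fintype Y₂]

omit [Fintype X] in
theorem errorProb_nonneg (ch : BroadcastChannel X Y₁ Y₂) {M₁ M₂ n : ℕ}
    (c : BroadcastCode X Y₁ Y₂ M₁ M₂ n) : 0 ≤ ch.errorProb c :=
  mul_nonneg (by positivity) (Finset.sum_nonneg fun _ _ => Finset.sum_nonneg fun _ _ =>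
    Finset.sum_nonneg fun _ _ => Finset.sum_nonneg fun _ _ => by
      split_ifs
      exacts [Finset.prod_nonneg fun _ _ => ch.nonneg _ _, le_rfl])

/-- Rates achieved by superposition coding: the cloud centres carry the message of the second
receiver and a part of rate `r` of the message of the first receiver. -/
theorem achievable_of_superposition (ch : BroadcastChannel X Y₁ Y₂) {U : Type*} [Fintype U]
    {P : U → ℝ} {κ : U → X → ℝ} (hP : P ∈ stdSimplex ℝ U) (hκ : ∀ u, κ u ∈ stdSimplex ℝ X)
    {R₂ r s : ℝ} (hR₂ : 0 ≤ R₂) (hr : 0 ≤ r) (hs : 0 ≤ s)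
    (h₂ : (R₂ = 0 ∧ r = 0) ∨ R₂ + r < outEntropy ch.marginal₂ (fun x => ∑ u, P u * κ u x)
      - ∑ u, P u * outEntropy ch.marginal₂ (κ u))
    (h₁ : s = 0 ∨ s < ∑ u, P u * outEntropy ch.marginal₁ (κ u)
      - ∑ x, (∑ u, P u * κ u x) * rowEntropy ch.marginal₁ x)
    (h₀ : (R₂ = 0 ∧ r = 0) ∨ R₂ + r + s < channelInfo ch.marginal₁ (fun x => ∑ u, P u * κ u x)) :
    ch.Achievable (r + s, R₂) := by
  -- Test exponents lie below the information, so missed detections vanish, and above the rate, so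
  -- false alarms vanish. At rate zero there is no wrong codeword and any exponent below the
  -- information works.
  have hγ : ∀ {p : Prop} {ρ I : ℝ}, p ∨ ρ < I → ∃ γ < I, p ∨ ρ < γ := fun {p ρ I} h => by
    rcases h with h | h
    · exact ⟨I - 1, by linarith, Or.inl h⟩
    · obtain ⟨γ, h1, h2⟩ := exists_between h
      exact ⟨γ, h2, Or.inr h1⟩
  obtain ⟨γ₂, hγ₂, hrate₂⟩ := hγ h₂
  obtain ⟨γ₁, hγ₁, hrate₁⟩ := hγ h₁
  obtain ⟨γ₀, hγ₀, hrate₀⟩ := hγ h₀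
  set W₁ := ch.marginal₁ with hW₁
  set W₂ := ch.marginal₂ with hW₂
  have hq₁ := chainLaw_mem_stdSimplex hP hκ ch.marginal₁_mem_stdSimplex
  have hq₂ := chainLaw_mem_stdSimplex hP hκ ch.marginal₂_mem_stdSimplex
  have miss₂ := tendsto_missed_detection hq₂ (γ := γ₂)
    (N := fun θ => condOut κ W₂ θ.1 θ.2.2) (D := fun θ => outLaw P κ W₂ θ.2.2)
    (fun θ h => (pos_of_chainLaw_pos hP hκ ch.marginal₂_mem_stdSimplex h).2.1)
    (fun θ h => (pos_of_chainLaw_pos hP hκ ch.marginal₂_mem_stdSimplex h).2.2) (by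
      simp only [mul_sub, Finset.sum_sub_distrib]
      rw [sum_chainLaw_logb_cond, sum_chainLaw_logb_output]
      linarith)
  have miss₁ := tendsto_missed_detection hq₁ (γ := γ₁)
    (N := fun θ => W₁ θ.2.1 θ.2.2) (D := fun θ => condOut κ W₁ θ.1 θ.2.2)
    (fun θ h => (pos_of_chainLaw_pos hP hκ ch.marginal₁_mem_stdSimplex h).1)
    (fun θ h => (pos_of_chainLaw_pos hP hκ ch.marginal₁_mem_stdSimplex h).2.1) (by
      simp only [mul_sub, Finset.sum_sub_distrib]
      rw [sum_chainLaw_logb_row, sum_chainLaw_logb_cond]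
      linarith)
  have miss₀ := tendsto_missed_detection hq₁ (γ := γ₀)
    (N := fun θ => W₁ θ.2.1 θ.2.2) (D := fun θ => outLaw P κ W₁ θ.2.2)
    (fun θ h => (pos_of_chainLaw_pos hP hκ ch.marginal₁_mem_stdSimplex h).1)
    (fun θ h => (pos_of_chainLaw_pos hP hκ ch.marginal₁_mem_stdSimplex h).2.2) (by
      simp only [mul_sub, Finset.sum_sub_distrib]
      rw [sum_chainLaw_logb_row, sum_chainLaw_logb_output]
      unfold channelInfo at hγ₀
      linarith)
  let M := fun (ρ : ℝ) (n : ℕ) => ⌈(2 : ℝ) ^ ((n : ℝ) * ρ)⌉₊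
  have hMpos : ∀ ρ n, 0 < M ρ n := fun ρ n => Nat.ceil_pos.2 (by positivity)
  have hM0 : ∀ n, M 0 n = 1 := fun n => by simp [M]
  have hMle : ∀ {ρ : ℝ}, 0 ≤ ρ → ∀ n, (M ρ n : ℝ) ≤ 2 * (2 : ℝ) ^ ((n : ℝ) * ρ) :=
    fun hρ n => ceil_two_rpow_le hρ n
  -- Rounding up each part separately leaves room for all messages.
  have hKL : ∀ n, M (r + s) n ≤ M r n * M s n := fun n => by
    refine Nat.ceil_le.2 ?_
    rw [mul_add, Real.rpow_add (by norm_num)]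
    push_cast
    exact mul_le_mul (Nat.le_ceil _) (Nat.le_ceil _) (by positivity) (by positivity)
  have hcloud : ∀ n, ((M R₂ n * M r n - 1 : ℕ) : ℝ) ≤ 4 * (2 : ℝ) ^ ((n : ℝ) * (R₂ + r)) := by
    intro n
    calc ((M R₂ n * M r n - 1 : ℕ) : ℝ) ≤ ((M R₂ n * M r n : ℕ) : ℝ) := by
          exact_mod_cast Nat.sub_le _ _
      _ = (M R₂ n : ℝ) * M r n := by push_cast; ring
      _ ≤ (2 * (2 : ℝ) ^ ((n : ℝ) * R₂)) * (2 * (2 : ℝ) ^ ((n : ℝ) * r)) :=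
          mul_le_mul (hMle hR₂ n) (hMle hr n) (by positivity) (by positivity)
      _ = _ := by rw [mul_add, Real.rpow_add (by norm_num)]; ring
  have count₂ : Tendsto (fun n => ((M R₂ n * M r n - 1 : ℕ) : ℝ) *
      (1 / (2 : ℝ) ^ ((n : ℝ) * γ₂))) atTop (𝓝 0) := by
    -- With zero rates there is exactly one cloud, so the number of wrong ones is 1 - 1 = 0.
    rcases hrate₂ with ⟨h, h'⟩ | h
    · simp [h, h', hM0]
    · exact tendsto_mul_one_div_two_rpow h hcloud
  have count₁ : Tendsto (fun n => ((M s n - 1 : ℕ) : ℝ) *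
      (1 / (2 : ℝ) ^ ((n : ℝ) * γ₁))) atTop (𝓝 0) := by
    rcases hrate₁ with h | h
    · simp [h, hM0]
    · refine tendsto_mul_one_div_two_rpow h fun n => le_trans ?_ (hMle hs n)
      exact_mod_cast Nat.sub_le _ _
  have count₀ : Tendsto (fun n => ((M R₂ n * M r n - 1 : ℕ) : ℝ) * (M s n *
      (1 / (2 : ℝ) ^ ((n : ℝ) * γ₀)))) atTop (𝓝 0) := by
    rcases hrate₀ with ⟨h, h'⟩ | h
    · simp [h, h', hM0]
    · have := tendsto_mul_one_div_two_rpow (a := fun n => (M R₂ n * M r n - 1) * M s n) (c := 8) h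
        fun n => by
          rw [Nat.cast_mul]
          refine (mul_le_mul (hcloud n) (hMle hs n) (by positivity) (by positivity)).trans_eq ?_
          rw [mul_add _ (R₂ + r), Real.rpow_add (by norm_num)]
          ring
      refine this.congr fun n => ?_
      rw [Nat.cast_mul, mul_assoc]
  have hcode := fun n : ℕ => (ch.power n).exists_superposition_code
    (prod_mem_stdSimplex (ι := Fin n) fun _ => hP)
    (κ := fun u x => ∏ i, κ (u i) (x i)) (fun u => prod_mem_stdSimplex fun i => hκ (u i))
    (hMpos (r + s) n) (hMpos R₂ n) (hKL n)
    (T₀ := (2 : ℝ) ^ ((n : ℝ) * γ₀)) (T₁ := (2 : ℝ) ^ ((n : ℝ) * γ₁))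
    (T₂ := (2 : ℝ) ^ ((n : ℝ) * γ₂)) (by positivity) (by positivity) (by positivity)
    -- Receiver 1 requires both tests: the first against a wrong satellite in the right cloud, the
    -- second against a wrong cloud.
    (G₁ := fun u x y =>
      (2 : ℝ) ^ ((n : ℝ) * γ₁) * ∏ i, condOut κ W₁ (u i) (y i) ≤ ∏ i, W₁ (x i) (y i) ∧
      (2 : ℝ) ^ ((n : ℝ) * γ₀) * ∏ i, outLaw P κ W₁ (y i) ≤ ∏ i, W₁ (x i) (y i))
    (G₂ := fun u y =>
      (2 : ℝ) ^ ((n : ℝ) * γ₂) * ∏ i, outLaw P κ W₂ (y i) ≤ ∏ i, condOut κ W₂ (u i) (y i))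
    (fun u x y h => by rw [marginal₁_power, outLaw_prod]; exact h.2)
    (fun u x y h => by rw [marginal₁_power, condOut_prod]; exact h.1)
    (fun u y h => by rw [marginal₂_power, outLaw_prod, condOut_prod]; exact h)
  choose enc d₁ d₂ hcode using hcode
  refine ⟨add_nonneg hr hs, hR₂, fun n => ⟨enc n, d₁ n, d₂ n⟩, ?_⟩
  have hlim := ((((miss₁.add miss₀).add count₁).add count₀).add (miss₂.add count₂))
  simp only [add_zero] at hlim
  refine squeeze_zero (fun n => ch.errorProb_nonneg _) (fun n => ?_) hlim
  have herr : ch.errorProb (⟨enc n, d₁ n, d₂ n⟩ :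
      BroadcastCode X Y₁ Y₂ (M (r + s) n) (M R₂ n) n) = 1 / ((M (r + s) n : ℝ) * M R₂ n) *
      ∑ w₁, ∑ w₂, ∑ y₁, ∑ y₂, (ch.power n).prob (enc n (w₁, w₂)) (y₁, y₂) *
        ind (d₁ n y₁ ≠ w₁ ∨ d₂ n y₂ ≠ w₂) := by
    rw [errorProb]
    congr 1
    refine Finset.sum_congr rfl fun w₁ _ => Finset.sum_congr rfl fun w₂ _ =>
      Finset.sum_congr rfl fun y₁ _ => Finset.sum_congr rfl fun y₂ _ => ?_
    split_ifs with h
    · rw [ind_of_true h, mul_one]; rfl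
    · rw [ind_of_false h, mul_zero]
  refine (herr.trans_le (hcode n)).trans ?_
  rw [marginal₁_power, marginal₂_power]
  refine add_le_add (add_le_add_left (add_le_add_left ?_ _) _) (add_le_add_left (le_of_eq ?_) _)
  · rw [sum_block_mul P κ W₁ fun u x y => ind (¬(
      (2 : ℝ) ^ ((n : ℝ) * γ₁) * ∏ i, condOut κ W₁ (u i) (y i) ≤ ∏ i, W₁ (x i) (y i) ∧
      (2 : ℝ) ^ ((n : ℝ) * γ₀) * ∏ i, outLaw P κ W₁ (y i) ≤ ∏ i, W₁ (x i) (y i))),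
      ← Finset.sum_add_distrib]
    refine Finset.sum_le_sum fun θ _ => ?_
    rw [← mul_add]
    refine mul_le_mul_of_nonneg_left ?_ (Finset.prod_nonneg fun i _ => hq₁.1 _)
    exact (ind_mono not_and_or.1).trans (ind_or_le _ _)
  · exact sum_block_mul P κ W₂ fun u x y => ind (¬(
      (2 : ℝ) ^ ((n : ℝ) * γ₂) * ∏ i, outLaw P κ W₂ (y i) ≤ ∏ i, condOut κ W₂ (u i) (y i)))

theorem infoAux₁_eq (ch : BroadcastChannel X Y₁ Y₂) {S : Type*} [Fintype S] (p : S × X → ℝ) :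
    ch.infoAux₁ p id = outEntropy ch.marginal₁ (law p Prod.snd)
      - (entropy (ch.joint p) (fun ω => (ω.1, ω.2.2.1)) - entropy (ch.joint p) (fun ω => ω.1)) := by
  have h := entropy_output (ch.joint p) (law_forget (law_forget_output (ch.law_joint p)).1)
  rw [law_joint_snd] at h
  simp only [infoAux₁, mutualInfo, id, ← h]
  ring

theorem infoInputGiven₁_nonneg (ch : BroadcastChannel X Y₁ Y₂) {S : Type*} [Fintype S]
    {p : S × X → ℝ} (hp : p ∈ stdSimplex ℝ (S × X)) : 0 ≤ ch.infoInputGiven₁ p id := by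
  have h := entropy_submodular (ch.joint_mem_stdSimplex hp) (fun ω => ω.2.1) (fun ω => ω.2.2.1)
    (fun ω => ω.1)
  simp only [infoInputGiven₁, condMutualInfo, id]
  linarith

theorem superpositionRegion_subset {ch : BroadcastChannel X Y₁ Y₂} {P : Set (X → ℝ)}
    (hP : ch.IsLessNoisyOn P) : ch.superpositionRegion P ⊆ ch.capacityRegion := by
  rintro ⟨R₁, R₂⟩ ⟨hR₁, hR₂, k, p, hp, hpP, hI₂, hI⟩
  dsimp only at hR₁ hR₂ hI₂ hI
  have hI₁ := hP k p hp hpP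
  have hJ := ch.infoInputGiven₁_nonneg hp
  obtain ⟨κ, hκ, hpκ⟩ := exists_disintegration hp
  have hfst := law_mem_stdSimplex hp Prod.fst
  have hsnd : law p Prod.snd = fun x => ∑ u, law p Prod.fst u * κ u x := by
    ext x; rw [law_snd]; simp only [hpκ]
  have hAB : ∀ u x, law (ch.joint p) (fun ω => (ω.1, ω.2.1)) (u, x)
      = law (ch.joint p) (fun ω => ω.1) u * κ u x := fun u x => by
    rw [law_joint_input, law_joint_fst, hpκ]
  have c₁ := condEntropy_output (ch.joint p) ch.sum_marginal₁ hκ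
    (law_forget_output (ch.law_joint p)).1 hAB
  have c₂ := condEntropy_output (ch.joint p) ch.sum_marginal₂ hκ
    (law_forget_output (ch.law_joint p)).2 hAB
  rw [law_joint_fst] at c₁ c₂
  have e₂ := ch.infoAux₂_eq p
  have e₁ := ch.infoAux₁_eq p
  have eJ := ch.infoInputGiven₁_eq p
  rw [c₂, hsnd] at e₂
  rw [c₁, hsnd] at e₁ eJ
  -- The satellites take as much of R₁ as I(X;Y₁|U) allows; the rest goes to the clouds, and both
  -- rate bounds together show that it fits.
  set m := min R₁ (ch.infoInputGiven₁ p id) with hm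
  have hm0 : 0 ≤ m := le_min hR₁ hJ
  have hm1 : m ≤ R₁ := min_le_left _ _
  have hm2 : m ≤ ch.infoInputGiven₁ p id := min_le_right _ _
  have hr : R₂ + (R₁ - m) ≤ ch.infoAux₂ p id := by
    rcases min_choice R₁ (ch.infoInputGiven₁ p id) with h | h <;> rw [hm, h] <;> linarith
  -- Scaling by t < 1 makes each inequality strict unless its rate is zero, the case allowed
  -- separately; t → 1 then reaches the closure.
  have hach : ∀ t : ℝ, 0 ≤ t → t < 1 → ch.Achievable (t * R₁, t * R₂) := by
    intro t ht0 ht1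
    have hlt : ∀ {a b : ℝ}, 0 ≤ a → a ≤ b → a = 0 ∨ t * a < b := fun {a b} ha hab => by
      rcases ha.eq_or_lt with h | h
      · exact Or.inl h.symm
      · exact Or.inr ((mul_lt_of_lt_one_left h ht1).trans_le hab)
    have hzero : R₂ + (R₁ - m) = 0 → t * R₂ = 0 ∧ t * (R₁ - m) = 0 := fun h => by
      have h1 : R₂ = 0 := by linarith
      have h2 : R₁ - m = 0 := by linarith
      simp [h1, h2]
    have h := ch.achievable_of_superposition hfst hκ (R₂ := t * R₂) (r := t * (R₁ - m))
      (s := t * m) (by positivity) (mul_nonneg ht0 (by linarith)) (by positivity) ?_ ?_ ?_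
    · rwa [← mul_add, sub_add_cancel] at h
    · rw [← e₂, ← mul_add]
      exact (hlt (by linarith) hr).imp_left hzero
    · rw [← eJ]
      exact (hlt hm0 hm2).imp_left fun h => by rw [h, mul_zero]
    · have hc : channelInfo ch.marginal₁ (fun x => ∑ u, law p Prod.fst u * κ u x)
          = ch.infoAux₁ p id + ch.infoInputGiven₁ p id := by rw [e₁, eJ, channelInfo]; ring
      rw [hc, ← mul_add, ← mul_add]
      -- Here the less noisy condition enters: R₁ + R₂ ≤ I(U;Y₂) + I(X;Y₁|U) ≤ I(U;Y₁) + I(X;Y₁|U) =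
      -- I(X;Y₁).
      refine (hlt (a := R₂ + (R₁ - m) + m) (by linarith) (by linarith)).imp_left fun h =>
        hzero (by linarith)
  have hlim : Tendsto (fun n : ℕ => ((1 - 1 / ((n : ℝ) + 1)) * R₁, (1 - 1 / ((n : ℝ) + 1)) * R₂))
      atTop (𝓝 (R₁, R₂)) := by
    have h := (tendsto_one_div_add_atTop_nhds_zero_nat (𝕜 := ℝ)).const_sub 1
    have h' := (h.mul_const R₁).prodMk_nhds (h.mul_const R₂)
    simpa using h'
  refine mem_closure_of_tendsto hlim (Eventually.of_forall fun n => hach _ ?_ ?_)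
  · have : 1 / ((n : ℝ) + 1) ≤ 1 := by
      rw [div_le_one (by positivity)]; linarith [n.cast_nonneg (α := ℝ)]
    linarith
  · have : 0 < 1 / ((n : ℝ) + 1) := by positivity
    linarith

theorem capacityRegion_subset {ch : BroadcastChannel X Y₁ Y₂} {P : Set (X → ℝ)}
    (hP : ch.IsSufficientClass P) : ch.capacityRegion ⊆ ch.superpositionRegion P := by
  intro R hR
  -- The closure is taken before passing to `P`, which is an arbitrary set of distributions and need
  -- not be closed.
  have hclosed : IsClosed {R : ℝ × ℝ | 0 ≤ R.1 ∧ 0 ≤ R.2 ∧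
      (R.2, R.1 + R.2) ∈ sumRegion ch.marginal₁ ch.marginal₂} :=
    (isClosed_le continuous_const continuous_fst).inter
      ((isClosed_le continuous_const continuous_snd).inter
        ((isClosed_sumRegion _ _).preimage (by fun_prop)))
  have hsub : {R | ch.Achievable R} ⊆ {R : ℝ × ℝ | 0 ≤ R.1 ∧ 0 ≤ R.2 ∧
      (R.2, R.1 + R.2) ∈ sumRegion ch.marginal₁ ch.marginal₂} :=
    fun R hR => ⟨hR.1, hR.2.1, Achievable.mem_sumRegion hR⟩
  obtain ⟨h1, h2, h3⟩ := closure_minimal hsub hclosed hR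
  exact mem_superpositionRegion_of_mem_sumRegion hP h1 h2 h3

end BroadcastChannel

end

/-- The capacity region of a discrete memoryless broadcast channel whose receiver `Y₁` is
essentially less noisy compared to `Y₂`, in terms of any sufficient class `P` that makes it so. -/
theorem mainTheorem1 {X Y₁ Y₂ : Type*} [Fintype X] [Fintype Y₁] [Fintype Y₂]
    (ch : BroadcastChannel X Y₁ Y₂) (P : Set (X → ℝ))
    (hP : ch.MakesEssentiallyLessNoisy P) :
    ch.capacityRegion = ch.superpositionRegion P :=
  (BroadcastChannel.capacityRegion_subset hP.1).antisymm
    (BroadcastChannel.superpositionRegion_subset hP.2)
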